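/- \textbf{Theorem.} There is an absolute constant $0<c_1<1$ such that the following holds. Let $0<\eta<3/8$, $0<\varepsilon<2^{-5}\eta$ and $\rho\ge 1$. There is $0<c=c(\varepsilon,\eta,\rho)<1$ such that for every $0<\delta<1$, with $\gamma=2^{-5}\delta\varepsilon\eta$, and every $n\in\mathbb N$ with $\varepsilon n\ge 1$, with $N=n+\lfloor\varepsilon n\rfloor=\lfloor(1+\varepsilon)n\rfloor$, the following is true. (Dimensions that are not integers are rounded down.) Let $E=(\mathbb R^N,\|\cdot\|)$ be a normed space whose unit ball $B_E$ satisfies $aB_2^N\subset B_E\subset B_2^N$ for some $0<a\le 1$, where $B_2^N$ is the Euclidean unit ball, and whose volume ratio satisfies $$\mathrm{vr}(E)=\bigl(\mathrm{vol}\,B_E/\mathrm{vol}\,\mathcal E_{\max}\bigr)^{1/N}\le\rho ,$$ where $\mathcal E_{\max}$ is the ellipsoid of maximal volume contained in $B_E$. For $1\le k\le N$ put $$V_k(E)=\sup\Bigl\{\bigl(\mathrm{vol}\,P_F(B_E)/\mathrm{vol}\,P_F(B_2^N)\bigr)^{1/k}\;:\;F\subset\mathbb R^N,\ \dim F=k\Bigr\},$$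 where $P_F$ is the orthogonal projection onto $F$. Let $g_1,\dots,g_{N-n}$ be independent random vectors on a probability space $(\Omega,\mathbf P)$, each with density $(n/2\pi)^{n/2}e^{-n\|x\|_2^2/2}$ on $\mathbb R^n$, and let $Q_\omega:\mathbb R^N\to\mathbb R^n$ be the linear map with $Q_\omega e_i=e_i$ for $i\le n$ and $Q_\omega e_{n+j}=g_j(\omega)$ for $1\le j\le N-n$. For a linear map $Q$ and a normed space $X$, let $Q(X)$ denote the range of $Q$ with the quotient norm, whose unit ball is the image of $B_X$. For a subspace $H\subset\mathbb R^n$ let $Q_H$ be the orthogonal projection in $\mathbb R^n$ with kernel $H$. A linear operator $T:\mathbb R^n\to\mathbb R^n$ is $(k,\beta)$-mixing if there is a subspace $F\subset\mathbb R^n$ with $\dim F\ge k$ and $\|P_{F^\perp}Tx\|_2\ge\beta\|x\|_2$ for all $x\in F$. Let $\tilde\Omega$ be the set of all $\omega\in\Omega$ such that $$\|Q_HT:Q_\omega(\ell_1^N)\to Q_HQ_\omega(E)\|\ \ge\ c\,V_{\lfloor\eta n/4\rfloor}(E)^{-1}a^{\delta}$$ for every $(\eta n,1)$-mixing operator $T$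 on $\mathbb R^n$ and every $\lfloor\gamma n\rfloor$-dimensional subspace $H\subset\mathbb R^n$. Then $\tilde\Omega$ is measurable and $$\mathbf P(\tilde\Omega)\ \ge\ 1-c_1^{\,n^2}.$$ -/

import Mathlib

open MeasureTheory ProbabilityTheory

noncomputable section

namespace RandomQuotients

/-- `ℝᵏ` with its natural Euclidean norm. -/
abbrev Euc (k : ℕ) : Type := EuclideanSpace ℝ (Fin k)

/-- The Euclidean unit ball `B₂ᵏ`. -/
def euclBall (k : ℕ) : Set (Euc k) := Metric.closedBall 0 1

/-- The unit ball `B_E` of `E = (ℝᴺ, p)`. -/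
def unitBall {N : ℕ} (p : Seminorm ℝ (Euc N)) : Set (Euc N) := {x | p x ≤ 1}

/-- The norm of `ℓ₁ᴺ`. -/
def l1Norm {N : ℕ} (x : Euc N) : ℝ := ∑ i, |x i|

/-- The `k`-dimensional Lebesgue measure on a subspace `F` (of dimension `k`): the Haar measure
giving measure one to the unit cube of an orthonormal basis of `F`. -/
def lebesgueOn {N : ℕ} (F : Submodule ℝ (Euc N)) : Measure F :=
  (stdOrthonormalBasis ℝ F).toBasis.addHaar

/-- The volume of the ellipsoid of maximal volume contained in `B_E`, as the supremum of the
volumes of the ellipsoids `A(B₂ᴺ) ⊆ B_E`, with `A` a linear automorphism of `ℝᴺ`. -/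
def maxEllipsoidVolume {N : ℕ} (p : Seminorm ℝ (Euc N)) : ℝ :=
  sSup {v : ℝ | ∃ A : Euc N ≃ₗ[ℝ] Euc N,
    A '' euclBall N ⊆ unitBall p ∧ v = volume.real (A '' euclBall N)}

/-- The volume ratio `vr(E) = (vol B_E / vol 𝓔_max)^{1/N}`. -/
def volumeRatio {N : ℕ} (p : Seminorm ℝ (Euc N)) : ℝ :=
  (volume.real (unitBall p) / maxEllipsoidVolume p) ^ (1 / (N : ℝ))

/-- `V_k(E)`: the supremum over the `k`-dimensional subspaces `F` of
`(vol P_F(B_E) / vol P_F(B₂ᴺ))^{1/k}`, where `P_F` is the orthogonal projection onto `F`. -/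
def volumeNumber {N : ℕ} (k : ℕ) (p : Seminorm ℝ (Euc N)) : ℝ :=
  sSup {v : ℝ | ∃ F : Submodule ℝ (Euc N), Module.finrank ℝ F = k ∧
    v = ((lebesgueOn F).real (F.orthogonalProjectionOnto '' unitBall p) /
      (lebesgueOn F).real (F.orthogonalProjectionOnto '' euclBall N)) ^ (1 / (k : ℝ))}

/-- `T ∈ Mix_n(k, β)`: there is a subspace `F` with `dim F ≥ k` and
`|P_{F^⊥} T x|₂ ≥ β |x|₂` for every `x ∈ F`. -/
def IsMixing {n : ℕ} (k β : ℝ) (T : Euc n →ₗ[ℝ] Euc n) : Prop :=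
  ∃ F : Submodule ℝ (Euc n), k ≤ (Module.finrank ℝ F : ℝ) ∧
    ∀ x ∈ F, β * ‖x‖ ≤ ‖Fᗮ.starProjection (T x)‖

/-- `Q_H`: the orthogonal projection in `ℝⁿ` with kernel `H`. -/
def projWithKer {n : ℕ} (H : Submodule ℝ (Euc n)) : Euc n →ₗ[ℝ] Euc n :=
  (Hᗮ.starProjection).toLinearMap

/-- The norm of the quotient space `Q(V)` of `V = (ℝᴺ, p)`, namely
`y ↦ inf {p x | Q x = y}`, for `y` in the range of `Q`. -/
def quotientNorm {N n : ℕ} (p : Euc N → ℝ) (Q : Euc N →ₗ[ℝ] Euc n) (y : Euc n) : ℝ :=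
  sInf (p '' {x | Q x = y})

/-- The norm of an operator `S` from a space normed by `p` to a space normed by `q`. -/
def operatorNorm {n : ℕ} (p q : Euc n → ℝ) (S : Euc n →ₗ[ℝ] Euc n) : ℝ :=
  sInf {t : ℝ | 0 ≤ t ∧ ∀ x, q (S x) ≤ t * p x}

/-- The map `Q : ℝ^{n+m} → ℝⁿ` with `Q e_i = e_i` for `i ≤ n` and `Q e_{n+j} = g_j` for
`j ≤ m`. -/
def quotientMap {n m : ℕ} (g : Fin m → Euc n) : Euc (n + m) →ₗ[ℝ] Euc n :=
  (EuclideanSpace.basisFun (Fin (n + m)) ℝ).toBasis.constr ℝ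
    (Fin.addCases (fun i : Fin n => EuclideanSpace.single i (1 : ℝ)) g)

/-- The law of a standard Gaussian vector in `ℝⁿ`, normalized to have the density
`(n/2π)^{n/2} exp(-n‖x‖₂²/2)` with respect to Lebesgue measure. -/
def gaussianLaw (n : ℕ) : Measure (Euc n) :=
  volume.withDensity fun x =>
    ENNReal.ofReal (((n : ℝ) / (2 * Real.pi)) ^ ((n : ℝ) / 2) * Real.exp (-(n * ‖x‖ ^ 2) / 2))

/-- `‖Q_H T : Q(ℓ₁ᴺ) → Q_H Q(E)‖` for `E = (ℝᴺ, p)`, where `Q` is the quotient map determined by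
the vectors `g_j`. -/
def compressedNorm {n m : ℕ} (p : Seminorm ℝ (Euc (n + m))) (g : Fin m → Euc n)
    (T : Euc n →ₗ[ℝ] Euc n) (H : Submodule ℝ (Euc n)) : ℝ :=
  operatorNorm (quotientNorm l1Norm (quotientMap g))
    (quotientNorm p (projWithKer H ∘ₗ quotientMap g)) (projWithKer H ∘ₗ T)

/-- The event that `‖Q_H T : Q_ω(ℓ₁ᴺ) → Q_H Q_ω(E)‖ ≥ r` for every `(k, 1)`-mixing operator `T` on
`ℝⁿ` and every `d`-dimensional subspace `H` of `ℝⁿ`. -/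
def goodEvent {Ω : Type*} {n m : ℕ} (p : Seminorm ℝ (Euc (n + m))) (g : Fin m → Ω → Euc n)
    (k : ℝ) (d : ℕ) (r : ℝ) : Set Ω :=
  {ω | ∀ T : Euc n →ₗ[ℝ] Euc n, IsMixing k 1 T →
    ∀ H : Submodule ℝ (Euc n), Module.finrank ℝ H = d →
      r ≤ compressedNorm p (fun j => g j ω) T H}

end RandomQuotients

end

/-! Write `N = n + m`, `d = dim H`, `k = ⌊ηn/4⌋`, `V = V_k(E)` and `r = c V⁻¹ a^δ`. The bad event is
covered by a family of simpler events whose size is controlled by nets, and each of them is too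
unlikely for the union to matter.

Suppose the norm is below `r` for some `T` and `H`. Modulo `H`, the images of the vertices of the ℓ₁
ball lift to vectors `x_i` of `r B_E`. The first `n` lifts are the columns of an operator `b` with
`T = Q b` modulo `H`; the last `m` give `Q (b g_j - x_{n+j}) ∈ H`. Since `Q` differs from the
projection `P` onto the first `n` coordinates by vectors of `span g`, the operator `B = P b` traps
each `B g_j` in `r P(B_E) + H + span g`. On a large part of the mixing subspace `T = B`, so `B` is
mixing there (`exists_mixing_lift`).

Since `B` and `H` depend on `g`, both are discretized. By the volume ratio, `exp(C n)` translates of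
an inscribed ellipsoid cover `B_E`; rounding to a lattice in the coordinates of the ellipsoid, with
signs chosen so that the error operator is bounded, gives a net of `exp(C n²)` operators
(`exists_column_net`). The error is harmless for mixing because the ellipsoid is thin, of radius
`2V`, off fewer than `k` dimensions (`exists_thin_subspace`). Subspaces are replaced by the ranges
of a net of `(3/a)^{dn}` maps (`exists_mem_trapEvent`).

For fixed `B`, `F`, `H`, move each `g_j` by a vector of the unit ball of `F`. The components of the
`g_j` orthogonal to `F` do not change, so the trap stays the same up to `F`, whereas mixing moves `B
g_j` in `k` directions orthogonal to the trap. There the body has volume at most `V^k` relative to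
the ball (`volume_trapped_le`). Averaging over the shifts bounds the probability by `(C^n (C r
V)^k)^m` (`pi_gaussianLaw_trapEvent_le`). As `km` is at least `εηn²/16` and `dn ≤ δkm`, a small `c`
beats the operator net and `a^{δkm}` beats the subspace net (`entropy_bound`). -/

noncomputable section

namespace RandomQuotients

open scoped Pointwise

/-! ### Packing and covering by volume. -/

section Covering

variable {V : Type*} [NormedAddCommGroup V] [NormedSpace ℝ V] [FiniteDimensional ℝ V]

theorem card_le_of_separated_of_measure_le [MeasurableSpace V] [BorelSpace V] (μ : Measure V)
    [μ.IsAddHaarMeasure] {K K' : Set V} {τ M : ℝ} (hτ : 0 < τ) (hM0 : 0 ≤ M)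
    (hK : ∀ x ∈ K, Metric.ball x (τ / 2) ⊆ K')
    (hM : μ K' ≤ ENNReal.ofReal M * μ (Metric.ball 0 (τ / 2))) (S : Finset V) (hS : ↑S ⊆ K)
    (hsep : ∀ x ∈ S, ∀ y ∈ S, x ≠ y → τ < ‖x - y‖) : (S.card : ℝ) ≤ M := by
  have hdisj : (S : Set V).PairwiseDisjoint fun x => Metric.ball x (τ / 2) := by
    intro x hx y hy hxy
    refine Metric.ball_disjoint_ball ?_
    have := hsep x hx y hy hxy
    rw [dist_eq_norm]; linarith
  have h1 : μ (⋃ x ∈ S, Metric.ball x (τ / 2)) = S.card * μ (Metric.ball 0 (τ / 2)) := by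
    rw [measure_biUnion_finset hdisj fun _ _ => Metric.isOpen_ball.measurableSet]
    simp [Measure.addHaar_ball_center]
  have h2 : (S.card : ENNReal) * μ (Metric.ball 0 (τ / 2))
      ≤ ENNReal.ofReal M * μ (Metric.ball 0 (τ / 2)) := by
    rw [← h1]
    refine (measure_mono ?_).trans hM
    exact Set.iUnion₂_subset fun x hx => hK x (hS hx)
  have hpos : μ (Metric.ball (0 : V) (τ / 2)) ≠ 0 :=
    (Metric.measure_ball_pos μ 0 (by positivity)).ne'
  have hfin : μ (Metric.ball (0 : V) (τ / 2)) ≠ ⊤ := measure_ball_lt_top.ne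
  have h3 := (ENNReal.mul_le_mul_iff_left hpos hfin).1 h2
  rw [← ENNReal.ofReal_natCast] at h3
  exact (ENNReal.ofReal_le_ofReal_iff hM0).1 h3

/-- A separated subset of maximal cardinality is a net. The set `K'` containing the half-radius
balls is left free, since it will be a dilate of a convex body. -/
theorem exists_finset_cover [MeasurableSpace V] [BorelSpace V] (μ : Measure V)
    [μ.IsAddHaarMeasure] {K K' : Set V} {τ M : ℝ} (hτ : 0 < τ) (hM0 : 0 ≤ M)
    (hK : ∀ x ∈ K, Metric.ball x (τ / 2) ⊆ K')
    (hM : μ K' ≤ ENNReal.ofReal M * μ (Metric.ball 0 (τ / 2))) :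
    ∃ S : Finset V, ↑S ⊆ K ∧ (S.card : ℝ) ≤ M ∧ ∀ x ∈ K, ∃ s ∈ S, ‖x - s‖ ≤ τ := by
  classical
  let C : Set ℕ := {k | ∃ S : Finset V, ↑S ⊆ K ∧
    (∀ x ∈ S, ∀ y ∈ S, x ≠ y → τ < ‖x - y‖) ∧ S.card = k}
  have hne : C.Nonempty := ⟨0, ∅, by simp⟩
  have hbdd : BddAbove C := by
    refine ⟨⌊M⌋₊, ?_⟩
    rintro k ⟨S, hS, hsep, rfl⟩
    exact Nat.le_floor (card_le_of_separated_of_measure_le μ hτ hM0 hK hM S hS hsep)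
  obtain ⟨S, hS, hsep, hcard⟩ := Nat.sSup_mem hne hbdd
  refine ⟨S, hS, card_le_of_separated_of_measure_le μ hτ hM0 hK hM S hS hsep, ?_⟩
  intro x hx
  by_contra! hcon
  have hxS : x ∉ S := fun h => by simpa using (hcon x h).trans' hτ
  have : (insert x S).card ≤ sSup C := by
    refine le_csSup hbdd ⟨insert x S, ?_, ?_, rfl⟩
    · intro y hy
      rcases Finset.mem_insert.1 (Finset.mem_coe.1 hy) with rfl | h
      exacts [hx, hS h]
    · intro y hy z hz hyz
      rcases Finset.mem_insert.1 hy with hy' | hy' <;>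
        rcases Finset.mem_insert.1 hz with hz' | hz'
      · exact absurd (hy'.trans hz'.symm) hyz
      · rw [hy']; exact hcon z hz'
      · rw [hz', norm_sub_rev]; exact hcon y hy'
      · exact hsep y hy' z hz' hyz
  rw [Finset.card_insert_of_notMem hxS] at this
  omega

theorem exists_finset_net_unitBall (V : Type*) [NormedAddCommGroup V] [NormedSpace ℝ V]
    [FiniteDimensional ℝ V] {τ : ℝ} (hτ : 0 < τ) :
    ∃ S : Finset V, (∀ s ∈ S, ‖s‖ ≤ 1) ∧
      (S.card : ℝ) ≤ (1 + 2 / τ) ^ Module.finrank ℝ V ∧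
      ∀ x : V, ‖x‖ ≤ 1 → ∃ s ∈ S, ‖x - s‖ ≤ τ := by
  borelize V
  have hK : ∀ x ∈ Metric.closedBall (0 : V) 1,
      Metric.ball x (τ / 2) ⊆ Metric.ball 0 (1 + τ / 2) := by
    intro x hx
    refine Metric.ball_subset_ball' ?_
    have : dist x 0 ≤ 1 := hx
    linarith
  have hM : Measure.addHaar (Metric.ball (0 : V) (1 + τ / 2)) ≤
      ENNReal.ofReal ((1 + 2 / τ) ^ Module.finrank ℝ V) *
        Measure.addHaar (Metric.ball (0 : V) (τ / 2)) := by
    rw [Measure.addHaar_ball_of_pos _ _ (by positivity),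
      Measure.addHaar_ball_of_pos _ _ (by positivity : 0 < τ / 2), ← mul_assoc,
      ← ENNReal.ofReal_mul (by positivity), ← mul_pow]
    refine le_of_eq ?_
    congr 3
    field_simp
    ring
  obtain ⟨S, h1, h2, h3⟩ := exists_finset_cover Measure.addHaar hτ (by positivity) hK hM
  refine ⟨S, fun s hs => by simpa using h1 hs, h2, fun x hx => h3 x (by simpa using hx)⟩

end Covering

/-! ### Derandomized rounding and norms tested on nets. -/

section Rounding

/-- This bounds the Laplace transform `φ` of a centred two-point variable. By Jensen `φ(-c) ≥ 1`, so
`φ(c) ≤ φ(c) φ(-c)`. The product is the transform of a symmetric variable and equals `1 +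
2t(1-t)(cosh c - 1) ≤ cosh c`. -/
theorem two_point_exp_le {t : ℝ} (h0 : 0 ≤ t) (h1 : t ≤ 1) (c : ℝ) :
    (1 - t) * Real.exp (c * (-t)) + t * Real.exp (c * (1 - t)) ≤ Real.exp (c ^ 2 / 2) := by
  have key : ∀ c : ℝ, 1 ≤ Real.exp (c * (-t)) * ((1 - t) + t * Real.exp c) := by
    intro c
    have h := convexOn_exp.2 (Set.mem_univ 0) (Set.mem_univ c) (by linarith : 0 ≤ 1 - t) h0
      (by ring)
    simp only [smul_eq_mul, mul_zero, zero_add, Real.exp_zero, mul_one] at h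
    calc (1 : ℝ) = Real.exp (c * (-t)) * Real.exp (t * c) := by
          rw [← Real.exp_add]; ring_nf; simp
      _ ≤ _ := by gcongr
  have e1 : (1 - t) * Real.exp (c * (-t)) + t * Real.exp (c * (1 - t))
      = Real.exp (c * (-t)) * ((1 - t) + t * Real.exp c) := by
    have : Real.exp (c * (1 - t)) = Real.exp (c * (-t)) * Real.exp c := by
      rw [← Real.exp_add]; ring_nf
    rw [this]; ring
  rw [e1]
  set X := Real.exp (c * (-t)) * ((1 - t) + t * Real.exp c) with hX
  have hX0 : 0 ≤ X := zero_le_one.trans (key c)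
  have h2 : X ≤ X * (Real.exp ((-c) * (-t)) * ((1 - t) + t * Real.exp (-c))) :=
    le_mul_of_one_le_right hX0 (key (-c))
  have e2 : X * (Real.exp ((-c) * (-t)) * ((1 - t) + t * Real.exp (-c)))
      = 1 + 2 * t * (1 - t) * (Real.cosh c - 1) := by
    have a1 : Real.exp (c * (-t)) * Real.exp ((-c) * (-t)) = 1 := by
      rw [← Real.exp_add]; ring_nf; simp
    have a2 : Real.exp c * Real.exp (-c) = 1 := by rw [← Real.exp_add]; simp
    rw [Real.cosh_eq]
    calc _ = (Real.exp (c * (-t)) * Real.exp ((-c) * (-t))) *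
          ((1 - t) ^ 2 + t * (1 - t) * (Real.exp c + Real.exp (-c))
            + t ^ 2 * (Real.exp c * Real.exp (-c))) := by rw [hX]; ring
      _ = _ := by rw [a1, a2]; ring
  have h3 : 2 * t * (1 - t) ≤ 1 := by nlinarith [sq_nonneg (t - 1 / 2)]
  have h4 : 1 ≤ Real.cosh c := Real.one_le_cosh c
  calc X ≤ 1 + 2 * t * (1 - t) * (Real.cosh c - 1) := h2.trans e2.le
    _ ≤ Real.cosh c := by nlinarith
    _ ≤ _ := Real.cosh_le_exp_half_sq c

/-- Method of conditional expectations: at each coordinate one of the two values does no worse than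
the mean. The weights `w` carry the exponential factors of the coordinates already split off in the
induction. -/
theorem exists_balanced_choice {ι κ : Type*} [DecidableEq κ] (S : Finset ι) (t : κ → ℝ)
    (h0 : ∀ k, 0 ≤ t k) (h1 : ∀ k, t k ≤ 1) (c : ι → κ → ℝ) (K : Finset κ) :
    ∀ w : ι → ℝ, (∀ s, 0 ≤ w s) → ∃ ε : κ → ℝ, (∀ k, ε k = -t k ∨ ε k = 1 - t k) ∧
      ∑ s ∈ S, w s * Real.exp (∑ k ∈ K, c s k * ε k)
        ≤ ∑ s ∈ S, w s * Real.exp (∑ k ∈ K, c s k ^ 2 / 2) := by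
  induction K using Finset.induction_on with
  | empty => intro w hw; exact ⟨fun k => -t k, fun k => Or.inl rfl, by simp⟩
  | insert k₀ K hk ih =>
    intro w hw
    obtain ⟨ε, hε, hle⟩ := ih (fun s => w s * Real.exp (c s k₀ ^ 2 / 2))
      fun s => mul_nonneg (hw s) (Real.exp_pos _).le
    let a : ι → ℝ := fun s => w s * Real.exp (∑ k ∈ K, c s k * ε k)
    have ha : ∀ s, 0 ≤ a s := fun s => mul_nonneg (hw s) (Real.exp_pos _).le
    have hmix : (1 - t k₀) * ∑ s ∈ S, a s * Real.exp (c s k₀ * (-t k₀))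
        + t k₀ * ∑ s ∈ S, a s * Real.exp (c s k₀ * (1 - t k₀))
        ≤ ∑ s ∈ S, a s * Real.exp (c s k₀ ^ 2 / 2) := by
      rw [Finset.mul_sum, Finset.mul_sum, ← Finset.sum_add_distrib]
      refine Finset.sum_le_sum fun s _ => ?_
      have := mul_le_mul_of_nonneg_left (two_point_exp_le (h0 k₀) (h1 k₀) (c s k₀)) (ha s)
      linarith
    have hex : ∃ e : ℝ, (e = -t k₀ ∨ e = 1 - t k₀) ∧
        ∑ s ∈ S, a s * Real.exp (c s k₀ * e) ≤ ∑ s ∈ S, a s * Real.exp (c s k₀ ^ 2 / 2) := by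
      by_contra! hcon
      have c1 := hcon _ (Or.inl rfl)
      have c2 := hcon _ (Or.inr rfl)
      rcases eq_or_lt_of_le (h0 k₀) with h | h
      · rw [← h] at hmix c1; linarith
      · nlinarith [h1 k₀, mul_lt_mul_of_pos_left c2 h,
          mul_le_mul_of_nonneg_left c1.le (sub_nonneg.2 (h1 k₀))]
    obtain ⟨e, he, hle2⟩ := hex
    refine ⟨Function.update ε k₀ e, ?_, ?_⟩
    · intro k
      by_cases hkk : k = k₀
      · subst hkk; simpa using he
      · simpa [hkk] using hε k
    · have l1 : ∀ s, w s * Real.exp (∑ k ∈ insert k₀ K, c s k * Function.update ε k₀ e k)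
          = a s * Real.exp (c s k₀ * e) := by
        intro s
        rw [Finset.sum_insert hk, Real.exp_add]
        have : ∑ k ∈ K, c s k * Function.update ε k₀ e k = ∑ k ∈ K, c s k * ε k := by
          refine Finset.sum_congr rfl fun k hkK => ?_
          rw [Function.update_of_ne (fun h => hk (by rw [← h]; exact hkK))]
        rw [this]
        simp [a]; ring
      calc _ = ∑ s ∈ S, a s * Real.exp (c s k₀ * e) := Finset.sum_congr rfl fun s _ => l1 s
        _ ≤ _ := hle2
        _ = ∑ s ∈ S, w s * Real.exp (c s k₀ ^ 2 / 2) * Real.exp (∑ k ∈ K, c s k * ε k) :=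
            Finset.sum_congr rfl fun s _ => by simp [a]; ring
        _ ≤ _ := hle
        _ = _ := Finset.sum_congr rfl fun s _ => by
            rw [Finset.sum_insert hk, Real.exp_add]; ring

/-- Replacing both arguments of the bilinear form by net points costs a quarter of the norm each, so
`‖L‖ ≤ B + ‖L‖ / 2`. -/
theorem norm_le_of_net {E F : Type*} [NormedAddCommGroup E] [InnerProductSpace ℝ E]
    [FiniteDimensional ℝ E] [NormedAddCommGroup F] [InnerProductSpace ℝ F]
    (L : E →ₗ[ℝ] F) {B : ℝ} (hB : 0 ≤ B) (X : Set E) (Y : Set F)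
    (hX1 : ∀ x ∈ X, ‖x‖ ≤ 1)
    (hX : ∀ x : E, ‖x‖ ≤ 1 → ∃ s ∈ X, ‖x - s‖ ≤ 1 / 4)
    (hY : ∀ y : F, ‖y‖ ≤ 1 → ∃ s ∈ Y, ‖y - s‖ ≤ 1 / 4)
    (hL : ∀ x ∈ X, ∀ y ∈ Y, inner ℝ y (L x) ≤ B) (x : E) : ‖L x‖ ≤ 2 * B * ‖x‖ := by
  let L' := L.toContinuousLinearMap
  have key : ∀ x : E, ‖x‖ = 1 → ‖L' x‖ ≤ B + ‖L'‖ / 2 := by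
    intro x hx
    obtain ⟨x', hx', hxx⟩ := hX x hx.le
    by_cases h0 : L' x = 0
    · rw [h0, norm_zero]; positivity
    let y : F := (‖L' x‖)⁻¹ • L' x
    have hpos : 0 < ‖L' x‖ := norm_pos_iff.2 h0
    have hy : ‖y‖ = 1 := by simp [y, norm_smul, hpos.ne']
    obtain ⟨y', hy', hyy⟩ := hY y hy.le
    have e : ‖L' x‖ = inner ℝ y (L' x) := by
      simp only [y, real_inner_smul_left, real_inner_self_eq_norm_sq]
      field_simp
    have e2 : inner ℝ y (L' x) = inner ℝ y' (L' x') + inner ℝ (y - y') (L' x')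
        + inner ℝ y (L' (x - x')) := by
      rw [map_sub, inner_sub_left, inner_sub_right]; ring
    have b1 : inner ℝ y' (L' x') ≤ B := hL x' hx' y' hy'
    have b2 : inner ℝ (y - y') (L' x') ≤ 1 / 4 * ‖L'‖ :=
      (real_inner_le_norm _ _).trans <| mul_le_mul hyy
        ((L'.le_opNorm x').trans (mul_le_of_le_one_right (norm_nonneg _) (hX1 x' hx')))
        (norm_nonneg _) (by norm_num)
    have b3 : inner ℝ y (L' (x - x')) ≤ ‖L'‖ * (1 / 4) := by
      refine (real_inner_le_norm _ _).trans ?_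
      rw [hy, one_mul]
      exact (L'.le_opNorm _).trans (by gcongr)
    rw [e, e2]; linarith
  have h := ContinuousLinearMap.opNorm_le_of_unit_norm (by positivity) key
  exact (L'.le_opNorm x).trans (by gcongr; linarith)

end Rounding

/-! ### Counting lattice points in a Euclidean ball. -/

section LatticeCount

theorem sum_Icc_half_pow_natAbs (K : ℕ) :
    ∑ z ∈ Finset.Icc (-(K : ℤ)) K, (1 / 2 : ℝ) ^ z.natAbs = 3 - 2 * (1 / 2) ^ K := by
  induction K with
  | zero => norm_num
  | succ K ih =>
    have h : Finset.Icc (-((K + 1 : ℕ) : ℤ)) ((K + 1 : ℕ) : ℤ)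
        = insert ((K + 1 : ℕ) : ℤ) (insert (-((K + 1 : ℕ) : ℤ)) (Finset.Icc (-(K : ℤ)) K)) := by
      ext z
      simp only [Finset.mem_Icc, Finset.mem_insert]
      push_cast
      omega
    rw [h, Finset.sum_insert, Finset.sum_insert, ih]
    · simp only [Int.natAbs_neg, Int.natAbs_natCast, pow_succ]; ring
    · simp only [Finset.mem_Icc]; push_cast; omega
    · simp only [Finset.mem_insert, Finset.mem_Icc]; push_cast; omega

/-- The integer points of the ball of radius `2 √N` in `ℝᴺ`. -/
def latticeBall (N : ℕ) : Finset (Fin N → ℤ) :=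
  {z ∈ Fintype.piFinset fun _ => Finset.Icc (-((4 * N : ℕ) : ℤ)) ((4 * N : ℕ) : ℤ) |
    ∑ k, z k ^ 2 ≤ 4 * N}

theorem natAbs_le_sq (z : ℤ) : (z.natAbs : ℤ) ≤ z ^ 2 := by
  rw [← Int.natAbs_sq]
  have : z.natAbs ≤ z.natAbs ^ 2 := Nat.le_self_pow two_ne_zero _
  exact_mod_cast this

theorem mem_latticeBall {N : ℕ} {z : Fin N → ℤ} : z ∈ latticeBall N ↔ ∑ k, z k ^ 2 ≤ 4 * N := by
  simp only [latticeBall, Finset.mem_filter, Fintype.mem_piFinset, Finset.mem_Icc,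
    and_iff_right_iff_imp]
  intro h k
  have h1 : z k ^ 2 ≤ ∑ k, z k ^ 2 :=
    Finset.single_le_sum (f := fun k => z k ^ 2) (fun k _ => sq_nonneg _) (Finset.mem_univ k)
  have h2 := natAbs_le_sq (z k)
  push_cast
  omega

/-- Give `z` the weight `2^{-∑|z_k|}`. Points of the ball weigh at least `2^{-4N}`, because `|z_k| ≤
z_k²`, and the total weight is at most `3^N`; hence `48 = 3 · 2⁴`. -/
theorem card_latticeBall_le (N : ℕ) : ((latticeBall N).card : ℝ) ≤ 48 ^ N := by
  have h1 : ∀ z ∈ latticeBall N, (1 / 2 : ℝ) ^ (4 * N) ≤ ∏ k, (1 / 2 : ℝ) ^ (z k).natAbs := by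
    intro z hz
    rw [Finset.prod_pow_eq_pow_sum]
    refine pow_le_pow_of_le_one (by norm_num) (by norm_num) ?_
    have := mem_latticeBall.1 hz
    have h2 : ((∑ k, (z k).natAbs : ℕ) : ℤ) ≤ ∑ k, z k ^ 2 := by
      push_cast
      exact Finset.sum_le_sum fun k _ => by simpa using natAbs_le_sq (z k)
    omega
  have hsub : latticeBall N ⊆ Fintype.piFinset fun _ =>
      Finset.Icc (-((4 * N : ℕ) : ℤ)) ((4 * N : ℕ) : ℤ) := Finset.filter_subset _ _
  have h2 : ((latticeBall N).card : ℝ) * (1 / 2 : ℝ) ^ (4 * N) ≤ 3 ^ N := by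
    calc _ = ∑ z ∈ latticeBall N, (1 / 2 : ℝ) ^ (4 * N) := by simp
      _ ≤ ∑ z ∈ latticeBall N, ∏ k, (1 / 2 : ℝ) ^ (z k).natAbs := Finset.sum_le_sum h1
      _ ≤ ∑ z ∈ Fintype.piFinset fun _ : Fin N =>
            Finset.Icc (-((4 * N : ℕ) : ℤ)) ((4 * N : ℕ) : ℤ),
            ∏ k, (1 / 2 : ℝ) ^ (z k).natAbs :=
          Finset.sum_le_sum_of_subset_of_nonneg hsub fun z _ _ =>
            Finset.prod_nonneg fun k _ => pow_nonneg (by norm_num) _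
      _ = ∏ _k : Fin N, ∑ z ∈ Finset.Icc (-((4 * N : ℕ) : ℤ)) ((4 * N : ℕ) : ℤ),
            (1 / 2 : ℝ) ^ z.natAbs := by rw [Finset.prod_univ_sum]
      _ ≤ _ := by
          rw [sum_Icc_half_pow_natAbs, Finset.prod_const, Finset.card_univ, Fintype.card_fin]
          refine pow_le_pow_left₀ ?_ ?_ N
          · have : (1 / 2 : ℝ) ^ (4 * N) ≤ 1 := pow_le_one₀ (by norm_num) (by norm_num)
            linarith
          · have : (0 : ℝ) ≤ (1 / 2) ^ (4 * N) := by positivity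
            linarith
  have h3 : (48 : ℝ) ^ N = 3 ^ N * 2 ^ (4 * N) := by
    rw [pow_mul, ← mul_pow]; norm_num
  have h4 : (1 / 2 : ℝ) ^ (4 * N) * 2 ^ (4 * N) = 1 := by rw [← mul_pow]; norm_num
  calc ((latticeBall N).card : ℝ)
      = (latticeBall N).card * (1 / 2 : ℝ) ^ (4 * N) * 2 ^ (4 * N) := by rw [mul_assoc, h4, mul_one]
    _ ≤ 3 ^ N * 2 ^ (4 * N) := by gcongr
    _ = _ := h3.symm

end LatticeCount

/-! ### Rounding an operator to the lattice with bounded error. -/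

section OperatorRounding

/-- The linear map whose matrix has the columns `c i`. -/
def columnMap {n N : ℕ} (c : Fin n → Euc N) : Euc n →ₗ[ℝ] Euc N :=
  (EuclideanSpace.basisFun (Fin n) ℝ).toBasis.constr ℝ c

theorem columnMap_apply {n N : ℕ} (c : Fin n → Euc N) (x : Euc n) :
    columnMap c x = ∑ i, x i • c i := by
  simp [columnMap, Module.Basis.constr_apply_fintype]

theorem columnMap_single {n N : ℕ} (c : Fin n → Euc N) (i : Fin n) :
    columnMap c (EuclideanSpace.single i 1) = c i := by
  rw [columnMap_apply, Finset.sum_eq_single i] <;> simp +contextual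

theorem map_eq_sum_single {n : ℕ} {F : Type*} [AddCommGroup F] [Module ℝ F]
    (L : Euc n →ₗ[ℝ] F) (x : Euc n) :
    L x = ∑ i, x i • L (EuclideanSpace.single i 1) := by
  conv_lhs => rw [← (EuclideanSpace.basisFun (Fin n) ℝ).sum_repr x]
  simp

/-- The point of the lattice `N^{-1/2} ℤᴺ` with coordinates `N^{-1/2} z`. -/
def latticePoint {N : ℕ} (z : Fin N → ℤ) : Euc N := WithLp.toLp 2 fun k => (z k : ℝ) / √N

theorem exists_lattice_rounding {n N : ℕ} (hN : 0 < N) (hn : n ≤ N) (e : Fin n → Euc N) :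
    ∃ z : Fin n → Fin N → ℤ, (∀ i k, |e i k - latticePoint (z i) k| ≤ 1 / √N) ∧
      ∀ x, ‖columnMap (fun i => e i - latticePoint (z i)) x‖ ≤ 14 * ‖x‖ := by
  have hN' : (0 : ℝ) < N := by exact_mod_cast hN
  have hs : 0 < √(N : ℝ) := Real.sqrt_pos.2 hN'
  have hss : √(N : ℝ) * √N = N := Real.mul_self_sqrt hN'.le
  obtain ⟨X, hX1, hXc, hX⟩ := exists_finset_net_unitBall (Euc n) (τ := 1 / 4) (by norm_num)
  obtain ⟨Y, hY1, hYc, hY⟩ := exists_finset_net_unitBall (Euc N) (τ := 1 / 4) (by norm_num)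
  rw [finrank_euclideanSpace_fin] at hXc hYc
  -- Quarter-nets have at most `9^n` and `9^N` points.
  norm_num at hXc hYc
  let f : Fin n × Fin N → ℝ := fun ik => √N * e ik.1 ik.2
  let c : Euc n × Euc N → Fin n × Fin N → ℝ := fun xy ik => √N * (xy.1 ik.1 * xy.2 ik.2)
  -- With `t = 1 - fract`, the values `-t` and `1 - t` are the errors of rounding up and down. The
  -- factor `√N` in `c` makes the exponent `N ⟨y, Lx⟩` and its variance term at most `N / 2`.
  obtain ⟨ε, hε, hle⟩ := exists_balanced_choice (X ×ˢ Y) (fun ik => 1 - Int.fract (f ik))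
    (fun ik => by linarith [Int.fract_lt_one (f ik)])
    (fun ik => by linarith [Int.fract_nonneg (f ik)]) c Finset.univ (fun _ => 1) (by simp)
  have hz : ∀ ik, ∃ z : ℤ, f ik - z = ε ik := by
    intro ik
    have hf : f ik - Int.fract (f ik) = ⌊f ik⌋ := Int.self_sub_fract _
    rcases hε ik with h | h
    · refine ⟨⌊f ik⌋ + 1, ?_⟩
      rw [h]; push_cast; linarith
    · refine ⟨⌊f ik⌋, ?_⟩
      rw [h]; linarith
  choose z hz using hz
  have hE : ∀ i k, e i k - latticePoint (fun k => z (i, k)) k = ε (i, k) / √N := by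
    intro i k
    rw [← hz (i, k)]
    simp only [latticePoint, f]
    field_simp
  refine ⟨fun i k => z (i, k), ?_, ?_⟩
  · intro i k
    rw [hE, abs_div, abs_of_pos hs]
    gcongr
    rw [abs_le]
    have a1 := Int.fract_lt_one (f (i, k))
    have a2 := Int.fract_nonneg (f (i, k))
    rcases hε (i, k) with h | h <;> rw [h] <;> constructor <;> linarith
  · intro x
    have hb := norm_le_of_net (B := 7)
      (columnMap fun i => e i - latticePoint fun k => z (i, k)) (by norm_num)
      (X : Set (Euc n)) (Y : Set (Euc N)) hX1 hX hY ?_ x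
    · norm_num at hb; exact hb
    intro x hx y hy
    simp only [one_mul] at hle
    have t1 : Real.exp (∑ k, c (x, y) k * ε k) ≤
        ∑ s ∈ X ×ˢ Y, Real.exp (∑ k, c s k * ε k) :=
      Finset.single_le_sum (f := fun s => Real.exp (∑ k, c s k * ε k))
        (fun s _ => (Real.exp_pos _).le) (Finset.mk_mem_product hx hy)
    have t2 : ∑ s ∈ X ×ˢ Y, Real.exp (∑ k, c s k ^ 2 / 2) ≤
        ∑ s ∈ X ×ˢ Y, Real.exp (N / 2) := by
      refine Finset.sum_le_sum fun s hs' => Real.exp_le_exp.2 ?_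
      obtain ⟨hs1, hs2⟩ := Finset.mem_product.1 hs'
      have e1 : ∑ k, c s k ^ 2 / 2 = N / 2 * (‖s.1‖ ^ 2 * ‖s.2‖ ^ 2) := by
        rw [EuclideanSpace.real_norm_sq_eq, EuclideanSpace.real_norm_sq_eq,
          Finset.sum_mul_sum, ← Finset.sum_product', Finset.mul_sum]
        refine Finset.sum_congr rfl fun k _ => ?_
        simp only [c]
        rw [mul_pow, Real.sq_sqrt hN'.le]; ring
      rw [e1]
      have b1 : ‖s.1‖ ^ 2 ≤ 1 := pow_le_one₀ (norm_nonneg _) (hX1 _ hs1)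
      have b2 : ‖s.2‖ ^ 2 ≤ 1 := pow_le_one₀ (norm_nonneg _) (hY1 _ hs2)
      have : ‖s.1‖ ^ 2 * ‖s.2‖ ^ 2 ≤ 1 := mul_le_one₀ b1 (by positivity) b2
      nlinarith
    -- There are at most `e^{6N}` pairs, so every pair satisfies `N ⟨y, Lx⟩ ≤ 7N`; the net argument
    -- doubles `7` to `14`.
    have t3 : ∑ s ∈ X ×ˢ Y, Real.exp (N / 2) ≤ Real.exp (7 * N) := by
      rw [Finset.sum_const, Finset.card_product, nsmul_eq_mul]
      push_cast
      have h9 : (9 : ℝ) ≤ Real.exp 3 := by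
        have h2 : (2.7 : ℝ) < Real.exp 1 := by linarith [Real.exp_one_gt_d9]
        calc (9 : ℝ) ≤ 2.7 ^ 3 := by norm_num
          _ ≤ Real.exp 1 ^ 3 := by gcongr
          _ = Real.exp 3 := by rw [← Real.exp_nat_mul]; norm_num
      have hX' : (X.card : ℝ) ≤ Real.exp (3 * N) := by
        calc (X.card : ℝ) ≤ 9 ^ n := hXc
          _ ≤ 9 ^ N := pow_le_pow_right₀ (by norm_num) hn
          _ ≤ Real.exp 3 ^ N := by gcongr
          _ = _ := by rw [← Real.exp_nat_mul]; ring_nf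
      have hY' : (Y.card : ℝ) ≤ Real.exp (3 * N) := by
        calc (Y.card : ℝ) ≤ 9 ^ N := hYc
          _ ≤ Real.exp 3 ^ N := by gcongr
          _ = _ := by rw [← Real.exp_nat_mul]; ring_nf
      calc (X.card : ℝ) * Y.card * Real.exp (N / 2)
          ≤ Real.exp (3 * N) * Real.exp (3 * N) * Real.exp (N / 2) := by gcongr
        _ = Real.exp (3 * N + 3 * N + N / 2) := by rw [← Real.exp_add, ← Real.exp_add]
        _ ≤ _ := Real.exp_le_exp.2 (by linarith)
    have t4 := Real.exp_le_exp.1 (t1.trans (hle.trans (t2.trans t3)))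
    have e2 : ∑ k, c (x, y) k * ε k =
        N * inner ℝ y (columnMap (fun i => e i - latticePoint fun k => z (i, k)) x) := by
      rw [columnMap_apply, inner_sum, Finset.mul_sum, Fintype.sum_prod_type]
      refine Finset.sum_congr rfl fun i _ => ?_
      rw [real_inner_smul_right, PiLp.inner_apply, Finset.mul_sum, Finset.mul_sum]
      refine Finset.sum_congr rfl fun k _ => ?_
      have : (e i - latticePoint fun k => z (i, k)) k = ε (i, k) / √N := hE i k
      rw [this]
      simp only [c, RCLike.inner_apply, conj_trivial]
      have q : (N : ℝ) / √N = √N := Real.div_sqrt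
      calc √N * (x i * y k) * ε (i, k) = (N / √N) * (x i * y k) * ε (i, k) := by rw [q]
        _ = _ := by ring
    rw [e2, mul_comm 7] at t4
    exact le_of_mul_le_mul_left t4 hN'

/-- The `N` coordinate errors of size `N^{-1/2}` add up to a column error of norm at most one, so a
rounded column has norm at most two. -/
theorem exists_lattice_rounding_of_norm_le {n N : ℕ} (hN : 0 < N) (hn : n ≤ N)
    (e : Fin n → Euc N) (he : ∀ i, ‖e i‖ ≤ 1) :
    ∃ z : Fin n → Fin N → ℤ, (∀ i, z i ∈ latticeBall N) ∧
      ∀ x, ‖columnMap (fun i => e i - latticePoint (z i)) x‖ ≤ 14 * ‖x‖ := by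
  obtain ⟨z, hz, hx⟩ := exists_lattice_rounding hN hn e
  refine ⟨z, fun i => mem_latticeBall.2 ?_, hx⟩
  have hN' : (0 : ℝ) < N := by exact_mod_cast hN
  have h1 : ‖e i - latticePoint (z i)‖ ≤ 1 := by
    rw [← sq_le_one_iff₀ (norm_nonneg _), EuclideanSpace.real_norm_sq_eq]
    calc ∑ k, (e i - latticePoint (z i)) k ^ 2 ≤ ∑ _k : Fin N, (1 / √(N : ℝ)) ^ 2 :=
          Finset.sum_le_sum fun k _ => sq_le_sq.2 ((hz i k).trans (le_abs_self _))
      _ = 1 := by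
          rw [div_pow, Real.sq_sqrt hN'.le]; simp; field_simp
  have h2 : ‖latticePoint (z i)‖ ≤ 2 := by
    have := norm_sub_norm_le (latticePoint (z i)) (e i)
    rw [norm_sub_rev] at this
    linarith [he i]
  have h3 : ‖latticePoint (z i)‖ ^ 2 = (∑ k, (z i k : ℝ) ^ 2) / N := by
    rw [EuclideanSpace.real_norm_sq_eq, Finset.sum_div]
    refine Finset.sum_congr rfl fun k _ => ?_
    simp only [latticePoint]
    rw [div_pow, Real.sq_sqrt hN'.le]
  have h4 : (∑ k, (z i k : ℝ) ^ 2) ≤ 4 * N := by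
    rw [← div_le_iff₀ hN', ← h3]
    nlinarith [norm_nonneg (latticePoint (z i))]
  exact_mod_cast h4

end OperatorRounding

/-! ### Singular values and Hilbert–Schmidt estimates. -/

section LinearAlgebra

theorem exists_submodule_finrank_eq {E : Type*} [AddCommGroup E] [Module ℝ E]
    (U : Submodule ℝ E) [FiniteDimensional ℝ U] {k : ℕ}
    (hk : k ≤ Module.finrank ℝ U) : ∃ U' ≤ U, Module.finrank ℝ U' = k := by
  obtain ⟨f, hf⟩ := exists_linearIndependent_of_le_finrank hk
  have hg : LinearIndependent ℝ fun i => (f i : E) :=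
    hf.map' U.subtype (Submodule.ker_subtype U)
  refine ⟨Submodule.span ℝ (Set.range fun i => (f i : E)), ?_, ?_⟩
  · rw [Submodule.span_le]
    rintro _ ⟨i, rfl⟩
    exact (f i).2
  · rw [finrank_span_eq_card hg, Fintype.card_fin]

variable {E F : Type*} [NormedAddCommGroup E] [InnerProductSpace ℝ E] [FiniteDimensional ℝ E]
  [NormedAddCommGroup F] [InnerProductSpace ℝ F] [FiniteDimensional ℝ F]

/-- Splitting of the domain into the spans of the right singular vectors with singular values
at most `t` and greater than `t`. -/
theorem exists_singular_split (B : E →ₗ[ℝ] F) {t : ℝ} (ht : 0 ≤ t) :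
    ∃ W : Submodule ℝ E, (∀ x ∈ W, ‖B x‖ ≤ t * ‖x‖) ∧ ∀ x ∈ Wᗮ, t * ‖x‖ ≤ ‖B x‖ := by
  have hT : (LinearMap.adjoint B ∘ₗ B).IsSymmetric := LinearMap.isSymmetric_adjoint_comp_self B
  set v := hT.eigenvectorBasis rfl with hv
  set l := hT.eigenvalues rfl with hl
  have hB : ∀ x, ‖B x‖ ^ 2 = ∑ i, l i * inner ℝ (v i) x ^ 2 := by
    intro x
    have h1 : ‖B x‖ ^ 2 = inner ℝ x ((LinearMap.adjoint B ∘ₗ B) x) := by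
      rw [LinearMap.comp_apply, LinearMap.adjoint_inner_right, real_inner_self_eq_norm_sq]
    rw [h1, ← v.sum_inner_mul_inner]
    refine Finset.sum_congr rfl fun i _ => ?_
    rw [← hT (v i) x, hT.apply_eigenvectorBasis, real_inner_comm (v i) x]
    simp only [RCLike.ofReal_real_eq_id, id_eq, real_inner_smul_left, ← hl, ← hv]
    ring
  have hx : ∀ x, ‖x‖ ^ 2 = ∑ i, inner ℝ (v i) x ^ 2 := fun x => by
    rw [← v.sum_sq_norm_inner_right x]; simp
  refine ⟨Submodule.span ℝ (v '' {i | l i ≤ t ^ 2}), fun x hxW => ?_, fun x hxW => ?_⟩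
  · have h0 : ∀ i, ¬ l i ≤ t ^ 2 → inner ℝ (v i) x = 0 := by
      intro i hi
      refine Submodule.span_induction (p := fun x _ => inner ℝ (v i) x = 0) ?_ (by simp) ?_ ?_ hxW
      · rintro _ ⟨j, hj, rfl⟩
        rw [v.inner_eq_ite, if_neg]
        rintro rfl; exact hi hj
      · intro x y _ _ hx hy; rw [inner_add_right, hx, hy, add_zero]
      · intro a x _ hx; rw [real_inner_smul_right, hx, mul_zero]
    refine abs_le_of_sq_le_sq' ?_ (by positivity) |>.2
    rw [mul_pow, hB, hx, Finset.mul_sum]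
    refine Finset.sum_le_sum fun i _ => ?_
    by_cases hi : l i ≤ t ^ 2
    · exact mul_le_mul_of_nonneg_right hi (sq_nonneg _)
    · rw [h0 i hi]; simp
  · have h0 : ∀ i, l i ≤ t ^ 2 → inner ℝ (v i) x = 0 := fun i hi =>
      (Submodule.mem_orthogonal _ _).1 hxW _ (Submodule.subset_span ⟨i, hi, rfl⟩)
    refine abs_le_of_sq_le_sq' ?_ (norm_nonneg _) |>.2
    rw [mul_pow, hB, hx, Finset.mul_sum]
    refine Finset.sum_le_sum fun i _ => ?_
    by_cases hi : l i ≤ t ^ 2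
    · rw [h0 i hi]; simp
    · exact mul_le_mul_of_nonneg_right (not_le.1 hi).le (sq_nonneg _)

theorem sum_norm_sq_orthonormal_le {ι κ : Type*} [Fintype ι] [Fintype κ] (B : E →ₗ[ℝ] F)
    (e : OrthonormalBasis ι ℝ E) {w : κ → E} (hw : Orthonormal ℝ w) :
    ∑ k, ‖B (w k)‖ ^ 2 ≤ ∑ i, ‖B (e i)‖ ^ 2 := by
  let f := stdOrthonormalBasis ℝ F
  have h1 : ∀ x, ‖B x‖ ^ 2 = ∑ k, inner ℝ x (LinearMap.adjoint B (f k)) ^ 2 := by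
    intro x
    rw [← f.sum_sq_norm_inner_right (B x)]
    refine Finset.sum_congr rfl fun k _ => ?_
    rw [LinearMap.adjoint_inner_right, real_inner_comm, Real.norm_eq_abs, sq_abs]
  simp only [h1]
  rw [Finset.sum_comm, Finset.sum_comm (s := (Finset.univ : Finset ι))]
  refine Finset.sum_le_sum fun k _ => ?_
  calc ∑ i, inner ℝ (w i) (LinearMap.adjoint B (f k)) ^ 2 ≤ ‖LinearMap.adjoint B (f k)‖ ^ 2 := by
        simpa using hw.sum_inner_products_le (x := LinearMap.adjoint B (f k)) (s := Finset.univ)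
    _ = _ := by rw [← e.sum_sq_norm_inner_right]; simp

/-- Chebyshev's inequality for singular values: the squared Hilbert–Schmidt norm is at most `n R²`,
which limits how many singular values exceed `t`. -/
theorem exists_bounded_subspace {n : ℕ} (B : Euc n →ₗ[ℝ] F) {t R : ℝ} (ht : 0 ≤ t)
    (hB : ∀ i, ‖B (EuclideanSpace.single i 1)‖ ≤ R) :
    ∃ W : Submodule ℝ (Euc n), (∀ x ∈ W, ‖B x‖ ≤ t * ‖x‖) ∧
      Module.finrank ℝ Wᗮ * t ^ 2 ≤ n * R ^ 2 := by
  obtain ⟨W, h1, h2⟩ := exists_singular_split B ht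
  refine ⟨W, h1, ?_⟩
  let w := stdOrthonormalBasis ℝ Wᗮ
  have hw : Orthonormal ℝ fun i => (w i : Euc n) :=
    w.orthonormal.comp_linearIsometry Wᗮ.subtypeₗᵢ
  have h3 := sum_norm_sq_orthonormal_le B (EuclideanSpace.basisFun (Fin n) ℝ) hw
  have h4 : ∑ i, ‖B (EuclideanSpace.basisFun (Fin n) ℝ i)‖ ^ 2 ≤ ∑ _i : Fin n, R ^ 2 :=
    Finset.sum_le_sum fun i _ => by
      rw [EuclideanSpace.basisFun_apply]
      exact pow_le_pow_left₀ (norm_nonneg _) (hB i) 2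
  have h5 : ∑ _k : Fin (Module.finrank ℝ Wᗮ), t ^ 2 ≤ ∑ k, ‖B (w k)‖ ^ 2 :=
    Finset.sum_le_sum fun k _ => by
      refine pow_le_pow_left₀ ht ?_ 2
      have := h2 (w k) (w k).2
      have hn : ‖(w k : Euc n)‖ = 1 := w.orthonormal.norm_eq_one k
      rwa [hn, mul_one] at this
  have := h5.trans (h3.trans h4)
  simpa using this

theorem norm_starProjection_le_of_le {A B : Submodule ℝ E} (h : A ≤ B) (x : E) :
    ‖A.starProjection x‖ ≤ ‖B.starProjection x‖ := by
  have : A.starProjection x = A.starProjection (B.starProjection x) := by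
    rw [← sub_eq_zero, ← map_sub, Submodule.starProjection_apply_eq_zero_iff]
    exact Submodule.orthogonal_le h (B.sub_starProjection_mem_orthogonal x)
  rw [this]
  exact A.norm_starProjection_apply_le _

end LinearAlgebra

/-! ### Ellipsoids in the unit ball and nets of operators. -/

section Body

variable {N : ℕ} {p : Seminorm ℝ (Euc N)} {a : ℝ}

theorem norm_le_seminorm (hp : unitBall p ⊆ euclBall N) (x : Euc N) : ‖x‖ ≤ p x := by
  refine le_of_forall_pos_le_add fun ε hε => ?_
  have hpos : 0 < p x + ε := by positivity
  have : (p x + ε)⁻¹ • x ∈ unitBall p := by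
    simp only [unitBall, Set.mem_ofPred_eq, map_smul_eq_mul, Real.norm_eq_abs, abs_inv,
      abs_of_pos hpos]
    rw [inv_mul_le_iff₀ hpos]; linarith
  have h2 := hp this
  simp only [euclBall, Metric.mem_closedBall, dist_zero_right, norm_smul, norm_inv,
    Real.norm_eq_abs, abs_of_pos hpos] at h2
  rw [inv_mul_le_iff₀ hpos] at h2
  linarith

theorem seminorm_le (ha : 0 < a) (hp : ∀ x ∈ euclBall N, a • x ∈ unitBall p) (x : Euc N) :
    p x ≤ a⁻¹ * ‖x‖ := by
  by_cases h0 : x = 0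
  · simp [h0]
  have hx : 0 < ‖x‖ := norm_pos_iff.2 h0
  have h := hp (‖x‖⁻¹ • x) (by simp [euclBall, norm_smul, hx.ne'])
  simp only [unitBall, Set.mem_ofPred_eq, map_smul_eq_mul, Real.norm_eq_abs, abs_of_pos ha,
    abs_inv, abs_norm] at h
  rw [inv_mul_eq_div, le_div_iff₀ ha]
  rw [← mul_assoc, mul_comm a, mul_assoc, inv_mul_le_iff₀ hx] at h
  linarith

theorem continuous_seminorm (ha : 0 < a) (hp : ∀ x ∈ euclBall N, a • x ∈ unitBall p) :
    Continuous p := by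
  have h : LipschitzWith (Real.toNNReal a⁻¹) p := by
    refine LipschitzWith.of_dist_le_mul fun x y => ?_
    rw [Real.dist_eq, dist_eq_norm, Real.coe_toNNReal _ (by positivity)]
    exact (abs_sub_map_le_sub p x y).trans (seminorm_le ha hp _)
  exact h.continuous

theorem measure_unitBall_lt_top (hp : unitBall p ⊆ euclBall N) : volume (unitBall p) < ⊤ :=
  (measure_mono hp).trans_lt measure_closedBall_lt_top

/-- The factor `2` pays for an ellipsoid of more than half the maximal volume, which makes
attainment of the supremum unnecessary. The ball of radius `a` shows that this supremum is positive.
-/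
theorem exists_ellipsoid (hN : 0 < N) {ρ : ℝ} (hρ : volumeRatio p ≤ ρ)
    (hp : unitBall p ⊆ euclBall N) (ha : 0 < a) (hp' : ∀ x ∈ euclBall N, a • x ∈ unitBall p) :
    ∃ A : Euc N ≃ₗ[ℝ] Euc N, (∀ x, p (A x) ≤ ‖x‖) ∧
      volume (unitBall p) ≤ ENNReal.ofReal (2 * ρ ^ N) * volume (A '' euclBall N) := by
  set S : Set ℝ := {v : ℝ | ∃ A : Euc N ≃ₗ[ℝ] Euc N,
    A '' euclBall N ⊆ unitBall p ∧ v = volume.real (A '' euclBall N)} with hS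
  have hM : maxEllipsoidVolume p = sSup S := rfl
  have hfin := measure_unitBall_lt_top hp
  let A₀ : Euc N ≃ₗ[ℝ] Euc N := LinearEquiv.smulOfNeZero ℝ _ a ha.ne'
  have hA₀ : A₀ '' euclBall N ⊆ unitBall p := by
    rintro _ ⟨x, hx, rfl⟩; exact hp' x hx
  have hbdd : BddAbove S := by
    refine ⟨volume.real (unitBall p), ?_⟩
    rintro _ ⟨A, hA, rfl⟩
    exact measureReal_mono hA hfin.ne
  have hpos₀ : 0 < volume.real (A₀ '' euclBall N) := by
    rw [measureReal_def, ENNReal.toReal_pos_iff]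
    refine ⟨?_, (measure_mono hA₀).trans_lt hfin⟩
    have : IsOpen (A₀ '' Metric.ball 0 1) :=
      A₀.toContinuousLinearEquiv.toHomeomorph.isOpenMap _ Metric.isOpen_ball
    exact (this.measure_pos volume (by simp)).trans_le
      (measure_mono (Set.image_mono Metric.ball_subset_closedBall))
  have hsup : 0 < sSup S := hpos₀.trans_le (le_csSup hbdd ⟨A₀, hA₀, rfl⟩)
  obtain ⟨_, ⟨A, hA, rfl⟩, hlt⟩ := exists_lt_of_lt_csSup (s := S) ⟨_, A₀, hA₀, rfl⟩
    (half_lt_self hsup)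
  refine ⟨A, fun x => ?_, ?_⟩
  · by_cases h0 : x = 0
    · simp [h0]
    have hx : 0 < ‖x‖ := norm_pos_iff.2 h0
    have h := hA ⟨‖x‖⁻¹ • x, by simp [euclBall, norm_smul, hx.ne'], rfl⟩
    simp only [unitBall, Set.mem_ofPred_eq, map_smul, map_smul_eq_mul, norm_inv, norm_norm] at h
    rw [inv_mul_le_iff₀ hx] at h
    linarith
  · have h1 : volume.real (unitBall p) / sSup S ≤ ρ ^ N := by
      have h0 : 0 ≤ volume.real (unitBall p) / sSup S := div_nonneg measureReal_nonneg hsup.le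
      have hN' : (N : ℝ) ≠ 0 := by exact_mod_cast hN.ne'
      have : ((volume.real (unitBall p) / sSup S) ^ (1 / (N : ℝ))) ^ N ≤ ρ ^ N :=
        pow_le_pow_left₀ (Real.rpow_nonneg h0 _) hρ N
      rwa [← Real.rpow_natCast, ← Real.rpow_mul h0, one_div_mul_cancel hN', Real.rpow_one] at this
    rw [div_le_iff₀ hsup] at h1
    have h2 : volume.real (unitBall p) ≤ 2 * ρ ^ N * volume.real (A '' euclBall N) := by
      have : 0 ≤ ρ ^ N := by
        by_contra! hneg
        have : 0 ≤ volume.real (unitBall p) := measureReal_nonneg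
        nlinarith
      nlinarith
    have hAfin : volume (A '' euclBall N) ≠ ⊤ := ((measure_mono hA).trans_lt hfin).ne
    rw [← ENNReal.ofReal_toReal hfin.ne, ← ENNReal.ofReal_toReal hAfin,
      ← ENNReal.ofReal_mul' ENNReal.toReal_nonneg]
    exact ENNReal.ofReal_le_ofReal h2

/-- In the coordinates of the ellipsoid the body contains the unit ball, so adding a ball of radius
`1/2` stays in its `3/2`-dilate. The volume count is `(3/2)^N · 2ρ^N · 2^N`. -/
theorem exists_ellipsoid_cover (A : Euc N ≃ₗ[ℝ] Euc N) (hA : ∀ x, p (A x) ≤ ‖x‖) {ρ : ℝ}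
    (hρ : 0 ≤ ρ)
    (hvol : volume (unitBall p) ≤ ENNReal.ofReal (2 * ρ ^ N) * volume (A '' euclBall N)) :
    ∃ S : Finset (Euc N), (S.card : ℝ) ≤ 2 * (3 * ρ) ^ N ∧
      ∀ x, p x ≤ 1 → ∃ s ∈ S, ‖A.symm x - s‖ ≤ 1 := by
  have hK : ∀ x ∈ A ⁻¹' unitBall p,
      Metric.ball x (1 / 2) ⊆ (3 / 2 : ℝ) • (A ⁻¹' unitBall p) := by
    intro x hx y hy
    rw [Set.mem_smul_set_iff_inv_smul_mem₀ (by norm_num)]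
    have hx' : p (A x) ≤ 1 := hx
    have h1 : p (A y) ≤ p (A x) + p (A (y - x)) := by
      have := map_add_le_add p (A x) (A (y - x))
      rwa [← map_add, add_sub_cancel] at this
    have h2 : p (A (y - x)) ≤ 1 / 2 := (hA _).trans (by
      rw [← dist_eq_norm]; exact (Metric.mem_ball.1 hy).le)
    simp only [Set.mem_preimage, unitBall, Set.mem_ofPred_eq, map_smul, map_smul_eq_mul]
    norm_num
    linarith
  have hM : volume ((3 / 2 : ℝ) • (A ⁻¹' unitBall p)) ≤
      ENNReal.ofReal (2 * (3 * ρ) ^ N) * volume (Metric.ball (0 : Euc N) (1 / 2)) := by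
    rw [Measure.addHaar_smul, Measure.addHaar_preimage_linearEquiv, finrank_euclideanSpace_fin,
      Measure.addHaar_ball_of_pos _ _ (by norm_num), finrank_euclideanSpace_fin]
    have h1 : volume (A '' euclBall N) =
        ENNReal.ofReal |LinearMap.det (A : Euc N →ₗ[ℝ] Euc N)| * volume (Metric.ball (0 : Euc N) 1) := by
      rw [← Measure.addHaar_unitClosedBall_eq_addHaar_unitBall]
      exact Measure.addHaar_image_linearMap volume (A : Euc N →ₗ[ℝ] Euc N) _
    rw [h1] at hvol
    have hd : |LinearMap.det (A.symm : Euc N →ₗ[ℝ] Euc N)| *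
        |LinearMap.det (A : Euc N →ₗ[ℝ] Euc N)| = 1 := by
      rw [← abs_mul, LinearEquiv.det_symm_mul_det, abs_one]
    calc _ ≤ ENNReal.ofReal |(3 / 2 : ℝ) ^ N| *
          (ENNReal.ofReal |LinearMap.det (A.symm : Euc N →ₗ[ℝ] Euc N)| *
          (ENNReal.ofReal (2 * ρ ^ N) * (ENNReal.ofReal |LinearMap.det (A : Euc N →ₗ[ℝ] Euc N)| *
            volume (Metric.ball (0 : Euc N) 1)))) := by gcongr
      _ = _ := by
        rw [← mul_assoc, ← mul_assoc, ← mul_assoc, ← mul_assoc,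
          ← ENNReal.ofReal_mul (by positivity), ← ENNReal.ofReal_mul (by positivity),
          ← ENNReal.ofReal_mul (by positivity), ← ENNReal.ofReal_mul (by positivity)]
        congr 2
        calc _ = |(3 / 2 : ℝ) ^ N| * (2 * ρ ^ N) *
              (|LinearMap.det (A.symm : Euc N →ₗ[ℝ] Euc N)| *
              |LinearMap.det (A : Euc N →ₗ[ℝ] Euc N)|) := by ring
          _ = _ := by
              rw [hd, abs_of_pos (by positivity), mul_pow, div_pow, div_pow]
              ring
  obtain ⟨S, -, h2, h3⟩ := exists_finset_cover volume (K := A ⁻¹' unitBall p) (τ := 1)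
    one_pos (by positivity) hK hM
  refine ⟨S, h2, fun x hx => h3 _ ?_⟩
  simpa [unitBall] using hx

/-- A net for the maps `ℝⁿ → E` which send the unit vectors into `r B_E`. -/
theorem exists_column_net {n : ℕ} (hN : 0 < N) (hn : n ≤ N) (A : Euc N ≃ₗ[ℝ] Euc N)
    (hA : ∀ x, p (A x) ≤ ‖x‖) {ρ : ℝ} (hρ : 0 ≤ ρ)
    (hvol : volume (unitBall p) ≤ ENNReal.ofReal (2 * ρ ^ N) * volume (A '' euclBall N))
    {r : ℝ} (hr : 0 < r) :
    ∃ B : Finset (Euc n →ₗ[ℝ] Euc N), (B.card : ℝ) ≤ (2 * (144 * ρ) ^ N) ^ n ∧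
      ∀ b : Fin n → Euc N, (∀ i, p (b i) ≤ r) → ∃ b' ∈ B, ∃ L : Euc n →ₗ[ℝ] Euc N,
        (∀ x, ‖L x‖ ≤ 14 * ‖x‖) ∧ ∀ x, columnMap b x = b' x + r • A (L x) := by
  classical
  obtain ⟨S, hS, hcov⟩ := exists_ellipsoid_cover A hA hρ hvol
  -- A column is encoded by the centre of a covering ellipsoid and a lattice point; `144 = 3 · 48`
  -- collects both counts.
  let T : Finset (Fin n → Euc N × (Fin N → ℤ)) :=
    Fintype.piFinset fun _ => S ×ˢ latticeBall N
  let Φ : (Fin n → Euc N × (Fin N → ℤ)) → (Euc n →ₗ[ℝ] Euc N) := fun c =>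
    columnMap fun i => r • A ((c i).1 + latticePoint (c i).2)
  refine ⟨T.image Φ, ?_, fun b hb => ?_⟩
  · calc ((T.image Φ).card : ℝ) ≤ T.card := by exact_mod_cast Finset.card_image_le
      _ = (S.card * (latticeBall N).card) ^ n := by
          simp [T, Fintype.card_piFinset, Finset.card_product]
      _ ≤ (2 * (3 * ρ) ^ N * 48 ^ N) ^ n := by
          gcongr
          exact card_latticeBall_le N
      _ = _ := by rw [mul_assoc, ← mul_pow]; ring_nf
  · have h1 : ∀ i, ∃ s ∈ S, ‖A.symm (r⁻¹ • b i) - s‖ ≤ 1 := fun i => hcov _ (by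
      rw [map_smul_eq_mul, norm_inv, Real.norm_eq_abs, abs_of_pos hr, inv_mul_le_iff₀ hr, mul_one]
      exact hb i)
    choose s hs hs1 using h1
    obtain ⟨z, hz, hzL⟩ := exists_lattice_rounding_of_norm_le hN hn
      (fun i => A.symm (r⁻¹ • b i) - s i) hs1
    refine ⟨Φ fun i => (s i, z i), Finset.mem_image_of_mem _ ?_, _, hzL, fun x => ?_⟩
    · exact Fintype.mem_piFinset.2 fun i => Finset.mk_mem_product (hs i) (hz i)
    · simp only [Φ, columnMap_apply, map_sum, Finset.smul_sum, ← Finset.sum_add_distrib]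
      refine Finset.sum_congr rfl fun i _ => ?_
      simp only [map_smul, map_sub, map_add, LinearEquiv.apply_symm_apply]
      rw [smul_comm r (x i), ← smul_add, ← smul_add]
      congr 1
      conv_lhs => rw [← smul_inv_smul₀ hr.ne' (b i)]
      congr 1
      abel

end Body

/-! ### Volume numbers and thin sections of the ellipsoid. -/

section VolumeNumber

variable {N k : ℕ} {p : Seminorm ℝ (Euc N)} {a : ℝ}

instance isAddHaarMeasure_lebesgueOn (F : Submodule ℝ (Euc N)) :
    (lebesgueOn F).IsAddHaarMeasure :=
  inferInstanceAs (stdOrthonormalBasis ℝ F).toBasis.addHaar.IsAddHaarMeasure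

theorem orthogonalProjectionOnto_image_euclBall (F : Submodule ℝ (Euc N)) :
    F.orthogonalProjectionOnto '' euclBall N = Metric.closedBall 0 1 := by
  ext y
  simp only [Set.mem_image, euclBall, Metric.mem_closedBall, dist_zero_right]
  constructor
  · rintro ⟨x, hx, rfl⟩
    exact (F.norm_orthogonalProjectionOnto_apply_le x).trans hx
  · intro hy
    exact ⟨y, by simpa using hy, by simp⟩

theorem lebesgueOn_proj_le_volumeNumber (hp : unitBall p ⊆ euclBall N) (hk : 1 ≤ k)
    (F : Submodule ℝ (Euc N)) (hF : Module.finrank ℝ F = k) :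
    lebesgueOn F (F.orthogonalProjectionOnto '' unitBall p) ≤
      ENNReal.ofReal (volumeNumber k p ^ k) * lebesgueOn F (Metric.closedBall 0 1) := by
  have hpos : ∀ F : Submodule ℝ (Euc N), 0 < (lebesgueOn F).real (Metric.closedBall 0 1) := by
    intro F
    rw [measureReal_def, ENNReal.toReal_pos_iff]
    exact ⟨Metric.measure_closedBall_pos _ _ one_pos, measure_closedBall_lt_top⟩
  have hsub : ∀ F : Submodule ℝ (Euc N),
      F.orthogonalProjectionOnto '' unitBall p ⊆ Metric.closedBall 0 1 := fun F => by
    rw [← orthogonalProjectionOnto_image_euclBall]; exact Set.image_mono hp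
  have hfin : lebesgueOn F (F.orthogonalProjectionOnto '' unitBall p) ≠ ⊤ :=
    ((measure_mono (hsub F)).trans_lt measure_closedBall_lt_top).ne
  -- The inclusion `B_E ⊆ B₂` bounds the ratios by one, so the real supremum really is an upper
  -- bound.
  have hbdd : BddAbove {v : ℝ | ∃ F : Submodule ℝ (Euc N), Module.finrank ℝ F = k ∧
    v = ((lebesgueOn F).real (F.orthogonalProjectionOnto '' unitBall p) /
      (lebesgueOn F).real (F.orthogonalProjectionOnto '' euclBall N)) ^ (1 / (k : ℝ))} := by
    refine ⟨1, ?_⟩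
    rintro _ ⟨F, -, rfl⟩
    refine Real.rpow_le_one (by positivity) ?_ (by positivity)
    rw [orthogonalProjectionOnto_image_euclBall]
    exact div_le_one_of_le₀ (measureReal_mono (hsub F) measure_closedBall_lt_top.ne)
      measureReal_nonneg
  have h1 : ((lebesgueOn F).real (F.orthogonalProjectionOnto '' unitBall p) /
      (lebesgueOn F).real (Metric.closedBall 0 1)) ^ (1 / (k : ℝ)) ≤ volumeNumber k p := by
    refine le_csSup hbdd ⟨F, hF, ?_⟩
    rw [orthogonalProjectionOnto_image_euclBall]
  have hk' : (k : ℝ) ≠ 0 := by positivity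
  have h0 : 0 ≤ (lebesgueOn F).real (F.orthogonalProjectionOnto '' unitBall p) /
      (lebesgueOn F).real (Metric.closedBall 0 1) := by positivity
  have h2 := pow_le_pow_left₀ (Real.rpow_nonneg h0 _) h1 k
  rw [← Real.rpow_natCast, ← Real.rpow_mul h0, one_div_mul_cancel hk', Real.rpow_one,
    div_le_iff₀ (hpos F)] at h2
  rw [← ENNReal.ofReal_toReal hfin, ← ENNReal.ofReal_toReal
    (measure_closedBall_lt_top (μ := lebesgueOn F) (x := 0) (r := 1)).ne,
    ← ENNReal.ofReal_mul' ENNReal.toReal_nonneg]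
  exact ENNReal.ofReal_le_ofReal h2

theorem volumeNumber_nonneg : 0 ≤ volumeNumber k p := by
  refine Real.sSup_nonneg ?_
  rintro _ ⟨F, -, rfl⟩
  positivity

theorem le_volumeNumber (hp : unitBall p ⊆ euclBall N) (hk : 1 ≤ k)
    (F : Submodule ℝ (Euc N)) (hF : Module.finrank ℝ F = k) {t : ℝ} (ht : 0 < t)
    (hball : ∀ y ∈ F, ‖y‖ ≤ t → p y ≤ 1) : t ≤ volumeNumber k p := by
  have h1 := lebesgueOn_proj_le_volumeNumber hp hk F hF
  have h2 : Metric.closedBall 0 t ⊆ F.orthogonalProjectionOnto '' unitBall p := by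
    intro y hy
    refine ⟨y, hball y y.2 (by simpa using hy), by simp⟩
  have h3 := (measure_mono h2).trans h1
  rw [Measure.addHaar_closedBall' _ _ ht.le, hF] at h3
  have h4 := (ENNReal.mul_le_mul_iff_left
    (Metric.measure_closedBall_pos (lebesgueOn F) 0 one_pos).ne'
    measure_closedBall_lt_top.ne).1 h3
  rw [ENNReal.ofReal_le_ofReal_iff (pow_nonneg volumeNumber_nonneg _)] at h4
  exact (pow_le_pow_iff_left₀ ht.le volumeNumber_nonneg (by omega)).1 h4

theorem volumeNumber_pos (hp : unitBall p ⊆ euclBall N) (ha : 0 < a)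
    (hp' : ∀ x ∈ euclBall N, a • x ∈ unitBall p) (hk : 1 ≤ k) (hkN : k ≤ N) :
    0 < volumeNumber k p := by
  obtain ⟨F, -, hF⟩ := exists_submodule_finrank_eq (⊤ : Submodule ℝ (Euc N)) (k := k)
    (by simpa using hkN)
  refine ha.trans_le (le_volumeNumber hp hk F hF ha fun y _ hy => ?_)
  refine (seminorm_le ha hp' y).trans ?_
  rw [inv_mul_le_iff₀ ha]; linarith

/-- Off a subspace of dimension less than `k`, an ellipsoid inscribed in `B_E` is contained in
the ball of radius `2 V_k(E)`. -/
theorem exists_thin_subspace (hp : unitBall p ⊆ euclBall N) (ha : 0 < a)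
    (hp' : ∀ x ∈ euclBall N, a • x ∈ unitBall p) (hk : 1 ≤ k) (hkN : k ≤ N)
    (A : Euc N ≃ₗ[ℝ] Euc N) (hA : ∀ x, p (A x) ≤ ‖x‖) :
    ∃ W : Submodule ℝ (Euc N), Module.finrank ℝ Wᗮ < k ∧
      ∀ x ∈ W, ‖A x‖ ≤ 2 * volumeNumber k p * ‖x‖ := by
  have hV := volumeNumber_pos hp ha hp' hk hkN
  obtain ⟨W, h1, h2⟩ := exists_singular_split (A : Euc N →ₗ[ℝ] Euc N)
    (t := 2 * volumeNumber k p) (by positivity)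
  refine ⟨W, ?_, h1⟩
  by_contra! hcon
  obtain ⟨U, hUW, hU⟩ := exists_submodule_finrank_eq Wᗮ hcon
  -- If `k` singular values were at least `2V`, a `k`-dimensional section of the ellipsoid, hence of
  -- `B_E`, would contain a ball of radius `2V`, forcing `2V ≤ V`.
  have h3 := le_volumeNumber hp hk (U.map (A : Euc N →ₗ[ℝ] Euc N))
    ((LinearEquiv.finrank_map_eq A U).trans hU) (t := 2 * volumeNumber k p) (by positivity) (by
      rintro _ ⟨u, hu, rfl⟩ hn
      have := h2 u (hUW hu)
      refine (hA u).trans ?_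
      have h4 := this.trans hn
      exact le_of_mul_le_mul_left (by linarith) (by positivity : 0 < 2 * volumeNumber k p))
  linarith

end VolumeNumber

/-! ### From sections along a subspace to the whole space. -/

section Shift

/-- Averaging the measure over translations by the unit ball of `F` and exchanging integrals leaves
base points in the ball of radius two, whence `2 ^ finrank E`. -/
theorem measure_inter_closedBall_le_of_section {E : Type*} [NormedAddCommGroup E]
    [NormedSpace ℝ E] [FiniteDimensional ℝ E] [MeasurableSpace E] [BorelSpace E] (μ : Measure E)
    [μ.IsAddHaarMeasure] (F : Submodule ℝ E) (ν : Measure F) [ν.IsAddHaarMeasure] {A : Set E}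
    (hA : MeasurableSet A) {κ : ENNReal}
    (h : ∀ x : E, ν {w : F | ‖w‖ ≤ 1 ∧ x + w ∈ A} ≤ κ * ν (Metric.closedBall 0 1)) :
    μ (A ∩ Metric.closedBall 0 1) ≤
      2 ^ Module.finrank ℝ E * κ * μ (Metric.closedBall 0 1) := by
  set A' := A ∩ Metric.closedBall (0 : E) 1 with hA'
  have hmA' : MeasurableSet A' := hA.inter Metric.isClosed_closedBall.measurableSet
  have hpos := (Metric.measure_closedBall_pos ν 0 one_pos).ne'
  have hfin : ν (Metric.closedBall 0 1) ≠ ⊤ := measure_closedBall_lt_top.ne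
  have hmeas : Measurable fun q : F × E => A'.indicator (1 : E → ENNReal) (q.2 + q.1) :=
    (measurable_one.indicator hmA').comp (by fun_prop)
  have h1 : ∫⁻ w in Metric.closedBall (0 : F) 1, ∫⁻ x, A'.indicator (1 : E → ENNReal) (x + w) ∂μ ∂ν
      = μ A' * ν (Metric.closedBall 0 1) := by
    simp_rw [lintegral_add_right_eq_self (μ := μ) (A'.indicator (1 : E → ENNReal)),
      lintegral_indicator_one hmA']
    rw [setLIntegral_const]
  have h2 : ∫⁻ w in Metric.closedBall (0 : F) 1, ∫⁻ x, A'.indicator (1 : E → ENNReal) (x + w) ∂μ ∂ν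
      ≤ κ * ν (Metric.closedBall 0 1) * μ (Metric.closedBall 0 2) := by
    rw [lintegral_lintegral_swap hmeas.aemeasurable]
    calc _ ≤ ∫⁻ x, (Metric.closedBall (0 : E) 2).indicator
          (fun _ => κ * ν (Metric.closedBall 0 1)) x ∂μ := by
          refine lintegral_mono fun x => ?_
          by_cases hx : x ∈ Metric.closedBall (0 : E) 2
          · rw [Set.indicator_of_mem hx]
            refine le_trans ?_ (h x)
            have hm : MeasurableSet {w : F | x + (w : E) ∈ A'} :=
              (measurable_const.add measurable_subtype_coe) hmA'
            have : ∀ w : F, A'.indicator (1 : E → ENNReal) (x + w) =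
              {w : F | x + (w : E) ∈ A'}.indicator 1 w := fun w => rfl
            simp_rw [this]
            rw [lintegral_indicator_one hm, Measure.restrict_apply hm]
            refine measure_mono ?_
            rintro w ⟨hw1, hw2⟩
            exact ⟨by simpa using hw2, hw1.1⟩
          · rw [Set.indicator_of_notMem hx]
            refine le_of_eq ?_
            have hm : Measurable fun w : F => A'.indicator (1 : E → ENNReal) (x + w) :=
              hmeas.comp (measurable_id.prodMk measurable_const)
            refine (lintegral_eq_zero_iff hm).2 ?_
            refine (ae_restrict_iff' Metric.isClosed_closedBall.measurableSet).2
              (Filter.Eventually.of_forall fun w hw => ?_)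
            refine Set.indicator_of_notMem (fun hmem => hx ?_) _
            have a1 : ‖x + w‖ ≤ 1 := by simpa using hmem.2
            have a2 : ‖(w : E)‖ ≤ 1 := by simpa using hw
            have a3 := norm_sub_le (x + w) (w : E)
            rw [add_sub_cancel_right] at a3
            simp only [Metric.mem_closedBall, dist_zero_right]
            linarith
      _ = _ := by
          rw [lintegral_indicator Metric.isClosed_closedBall.measurableSet, setLIntegral_const]
  rw [h1] at h2
  have h3 : μ (Metric.closedBall (0 : E) 2)
      = 2 ^ Module.finrank ℝ E * μ (Metric.closedBall 0 1) := by
    rw [Measure.addHaar_closedBall' _ _ (by norm_num), ENNReal.ofReal_pow (by norm_num)]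
    norm_num
  rw [h3] at h2
  refine (ENNReal.mul_le_mul_iff_left hpos hfin).1 (h2.trans (le_of_eq ?_))
  ring

end Shift

/-! ### Coordinate maps between `ℝⁿ` and `ℝⁿ⁺ᵐ`. -/

section Coordinates

variable {n m : ℕ}

/-- The projection onto the first `n` coordinates. -/
def firstCoords (n m : ℕ) : Euc (n + m) →ₗ[ℝ] Euc n where
  toFun x := WithLp.toLp 2 fun i => x (Fin.castAdd m i)
  map_add' _ _ := rfl
  map_smul' _ _ := rfl

/-- The projection onto the last `m` coordinates. -/
def lastCoords (n m : ℕ) : Euc (n + m) →ₗ[ℝ] Euc m where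
  toFun x := WithLp.toLp 2 fun i => x (Fin.natAdd n i)
  map_add' _ _ := rfl
  map_smul' _ _ := rfl

/-- The embedding of `ℝⁿ` as the first `n` coordinates of `ℝⁿ⁺ᵐ`. -/
def padZero (n m : ℕ) : Euc n →ₗ[ℝ] Euc (n + m) where
  toFun x := WithLp.toLp 2 (Fin.addCases (fun i => x i) fun _ => 0)
  map_add' x y := by ext i; refine Fin.addCases (fun i => ?_) (fun i => ?_) i <;> simp
  map_smul' c x := by ext i; refine Fin.addCases (fun i => ?_) (fun i => ?_) i <;> simp

@[simp]
theorem firstCoords_apply (x : Euc (n + m)) (i : Fin n) :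
    firstCoords n m x i = x (Fin.castAdd m i) := rfl

@[simp]
theorem lastCoords_apply (x : Euc (n + m)) (i : Fin m) :
    lastCoords n m x i = x (Fin.natAdd n i) := rfl

@[simp]
theorem padZero_castAdd (x : Euc n) (i : Fin n) : padZero n m x (Fin.castAdd m i) = x i := by
  simp [padZero]

@[simp]
theorem padZero_natAdd (x : Euc n) (i : Fin m) : padZero n m x (Fin.natAdd n i) = 0 := by
  simp [padZero]

theorem inner_padZero (x : Euc n) (y : Euc (n + m)) :
    inner ℝ (padZero n m x) y = inner ℝ x (firstCoords n m y) := by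
  simp [PiLp.inner_apply, Fin.sum_univ_add]

theorem firstCoords_padZero (x : Euc n) : firstCoords n m (padZero n m x) = x := by
  ext i; simp

theorem norm_padZero (x : Euc n) : ‖padZero n m x‖ = ‖x‖ := by
  rw [← sq_eq_sq₀ (norm_nonneg _) (norm_nonneg _), ← real_inner_self_eq_norm_sq,
    ← real_inner_self_eq_norm_sq, inner_padZero, firstCoords_padZero]

theorem norm_firstCoords_le (x : Euc (n + m)) : ‖firstCoords n m x‖ ≤ ‖x‖ := by
  rw [← sq_le_sq₀ (norm_nonneg _) (norm_nonneg _), EuclideanSpace.real_norm_sq_eq,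
    EuclideanSpace.real_norm_sq_eq, Fin.sum_univ_add]
  simp only [firstCoords_apply]
  exact le_add_of_nonneg_right (Finset.sum_nonneg fun _ _ => sq_nonneg _)

theorem quotientMap_apply (g : Fin m → Euc n) (x : Euc (n + m)) :
    quotientMap g x = firstCoords n m x + ∑ j, lastCoords n m x j • g j := by
  rw [quotientMap, Module.Basis.constr_apply_fintype, Fin.sum_univ_add]
  congr 1
  · ext i
    simp [Finset.sum_apply, Pi.single_apply]
  · simp

end Coordinates

/-! ### Small-ball estimate for a mixing operator. -/

section SmallBall

variable {n m k : ℕ} {p : Seminorm ℝ (Euc (n + m))} {a : ℝ}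

theorem isOpen_thickening (hc : Continuous p) {s : ℝ} (hs : s ≠ 0) (Y : Submodule ℝ (Euc n)) :
    IsOpen {z : Euc n | ∃ κ, p κ < 1 ∧ z - s • firstCoords n m κ ∈ Y} := by
  have hsurj : Function.Surjective (firstCoords n m) := fun x => ⟨_, firstCoords_padZero x⟩
  have h1 : IsOpen {κ | p κ < 1} := isOpen_lt hc continuous_const
  have h2 : IsOpen ((firstCoords n m) '' {κ | p κ < 1}) :=
    (firstCoords n m).isOpenMap_of_finiteDimensional hsurj _ h1
  have h3 : IsOpen (s • ((firstCoords n m) '' {κ | p κ < 1}) + (Y : Set (Euc n))) :=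
    (h2.smul₀ hs).add_right
  convert h3 using 1
  ext z
  simp only [Set.mem_ofPred_eq, Set.mem_add, Set.mem_smul_set, Set.mem_image]
  constructor
  · rintro ⟨κ, h, hz⟩
    exact ⟨_, ⟨_, ⟨κ, h, rfl⟩, rfl⟩, _, hz, by abel⟩
  · rintro ⟨_, ⟨_, ⟨κ, h, rfl⟩, rfl⟩, y, hy, rfl⟩
    exact ⟨κ, h, by rw [add_sub_cancel_left]; exact hy⟩

theorem finrank_comap_orthogonal {E F : Type*} [NormedAddCommGroup E] [InnerProductSpace ℝ E]
    [FiniteDimensional ℝ E] [AddCommGroup F] [Module ℝ F] [FiniteDimensional ℝ F]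
    (L : F →ₗ[ℝ] E) (Y : Submodule ℝ E) :
    Module.finrank ℝ F ≤ Module.finrank ℝ (Yᗮ.comap L) + Module.finrank ℝ Y := by
  let φ : F →ₗ[ℝ] Y := (Y.orthogonalProjectionOnto : E →ₗ[ℝ] Y) ∘ₗ L
  have h1 : Yᗮ.comap L = LinearMap.ker φ := by
    ext x
    rw [Submodule.mem_comap, LinearMap.mem_ker]
    exact (Submodule.orthogonalProjectionOnto_eq_zero_iff).symm
  have h2 := LinearMap.finrank_range_add_finrank_ker φ
  have h3 := Submodule.finrank_le (LinearMap.range φ)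
  rw [h1]; omega

/-- Mixing gives `k` directions in `F` which `P_{F^⊥} B` sends injectively onto a space `G`
orthogonal to `F ⊔ Y`. Along them the trapped points project into a translate of `s P_G(B_E)`, and
the volume number controls this projection. -/
theorem volume_trapped_le (hp : unitBall p ⊆ euclBall (n + m)) (hc : Continuous p) (hk : 1 ≤ k)
    (F Y : Submodule ℝ (Euc n)) (B : Euc n →ₗ[ℝ] Euc n)
    (hB : ∀ x ∈ F, ‖x‖ ≤ 2 * ‖Fᗮ.starProjection (B x)‖)
    (hY : Module.finrank ℝ Y + k ≤ Module.finrank ℝ F) (x₀ : Euc n) {s : ℝ} (hs : 0 < s) :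
    volume {v : F | ‖v‖ ≤ 1 ∧ ∃ κ, p κ < 1 ∧ B (x₀ + v) - s • firstCoords n m κ ∈ F ⊔ Y} ≤
      2 ^ Module.finrank ℝ F * ENNReal.ofReal ((2 * s * volumeNumber k p) ^ k) *
        volume (Metric.closedBall (0 : F) 1) := by
  let L : F →ₗ[ℝ] Euc n := (Fᗮ.starProjection : Euc n →ₗ[ℝ] Euc n) ∘ₗ B ∘ₗ F.subtype
  have hL : ∀ x : F, L x = Fᗮ.starProjection (B x) := fun x => rfl
  have hF1 : k ≤ Module.finrank ℝ (Yᗮ.comap L) := by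
    have := finrank_comap_orthogonal L Y; omega
  obtain ⟨F₁, hF₁, hdim⟩ := exists_submodule_finrank_eq _ hF1
  let Λ : F₁ →ₗ[ℝ] Euc (n + m) := padZero n m ∘ₗ L ∘ₗ F₁.subtype
  have hΛ : ∀ w : F₁, ‖w‖ ≤ 2 * ‖Λ w‖ := fun w => by
    have := hB w.1 w.1.2
    calc ‖w‖ = ‖(w.1 : Euc n)‖ := rfl
      _ ≤ _ := this
      _ = _ := by
        show _ = 2 * ‖padZero n m (L w.1)‖
        rw [norm_padZero]; rfl
  have hinj : Function.Injective Λ := by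
    rw [injective_iff_map_eq_zero]
    intro w hw
    have := hΛ w
    rw [hw, norm_zero, mul_zero] at this
    exact norm_le_zero_iff.1 this
  let G : Submodule ℝ (Euc (n + m)) := LinearMap.range Λ
  let e : F₁ ≃ₗ[ℝ] G := LinearEquiv.ofInjective Λ hinj
  have he : ∀ w, (e w : Euc (n + m)) = Λ w := fun w => rfl
  have hG : Module.finrank ℝ G = k := e.finrank_eq.symm.trans hdim
  let e' : G ≃L[ℝ] F₁ := e.symm.toContinuousLinearEquiv
  -- Lebesgue measure is pulled back from `G`, so no determinant of `Λ` enters; only the lower bound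
  -- `1/2` on `Λ` is needed.
  let ν : Measure F₁ := (lebesgueOn G).map e'
  have hν : ∀ S : Set F₁, ν S = lebesgueOn G (e' ⁻¹' S) := fun S =>
    (e'.toHomeomorph.toMeasurableEquiv).map_apply S
  set A : Set F := {v : F | ∃ κ, p κ < 1 ∧ B (x₀ + v) - s • firstCoords n m κ ∈ F ⊔ Y} with hA
  have hAo : IsOpen A := by
    have hcont : Continuous fun v : F => B (x₀ + v) :=
      B.continuous_of_finiteDimensional.comp (by fun_prop)
    exact (isOpen_thickening hc hs.ne' (F ⊔ Y)).preimage hcont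
  have hball : Metric.closedBall (0 : G) (1 / 2) ⊆ e' ⁻¹' Metric.closedBall 0 1 := by
    intro y hy
    have h1 := hΛ (e' y)
    have h2 : Λ (e' y) = y := by
      rw [← he]; exact congrArg _ (e.apply_symm_apply y)
    rw [h2] at h1
    simp only [Metric.mem_closedBall, dist_zero_right] at hy
    simp only [Set.mem_preimage, Metric.mem_closedBall, dist_zero_right]
    exact (h1.trans (mul_le_mul_of_nonneg_left hy zero_le_two)).trans (by norm_num)
  have hsec : ∀ x : F, ν {w : F₁ | ‖w‖ ≤ 1 ∧ x + w ∈ A} ≤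
      ENNReal.ofReal ((2 * s * volumeNumber k p) ^ k) * ν (Metric.closedBall 0 1) := by
    intro x
    have hsub : e' ⁻¹' {w : F₁ | ‖w‖ ≤ 1 ∧ x + w ∈ A} ⊆
        (fun y => -G.orthogonalProjectionOnto (padZero n m (B (x₀ + x))) + y) ''
          (s • (G.orthogonalProjectionOnto '' unitBall p)) := by
      intro y hy
      obtain ⟨-, κ, hκ, hmem⟩ := hy
      have hw : Λ (e' y) = y := by
        rw [← he]; exact congrArg _ (e.apply_symm_apply y)
      refine ⟨s • G.orthogonalProjectionOnto κ, Set.smul_mem_smul_set ⟨κ, hκ.le, rfl⟩, ?_⟩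
      -- Orthogonality of `G` to `F ⊔ Y` removes the unknown vector of the trap, and `G` inside the
      -- copy of `Fᗮ` lets `B w` be replaced by `L w`.
      have horth : ∀ g ∈ G, inner ℝ g
          (padZero n m (B (x₀ + x)) + y - s • κ) = 0 := by
        rintro _ ⟨f, rfl⟩
        have hf1 : L f ∈ Fᗮ := Fᗮ.starProjection_apply_mem _
        have hf2 : L f ∈ Yᗮ := hF₁ f.2
        have hf : L f ∈ (F ⊔ Y)ᗮ := by rw [← Submodule.inf_orthogonal]; exact ⟨hf1, hf2⟩
        have h1 : inner ℝ (L f) (B (x₀ + (x + (e' y : F) : F)) - s • firstCoords n m κ) = 0 :=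
          (Submodule.mem_orthogonal' _ _).1 hf _ hmem
        have h2 : inner ℝ (L f) (B ((e' y : F) : Euc n)) = inner ℝ (L f) (L (e' y : F)) := by
          rw [hL (e' y : F), ← Submodule.inner_starProjection_left_eq_right,
            Submodule.starProjection_eq_self_iff.2 hf1]
        have h3 : Λ f = padZero n m (L f) := rfl
        rw [h3, inner_padZero, map_sub, map_add, firstCoords_padZero, map_smul, ← hw]
        have h4 : firstCoords n m (Λ (e' y)) = L (e' y : F) := firstCoords_padZero _
        rw [h4, inner_sub_right, inner_add_right, ← h2, ← inner_add_right, ← inner_sub_right,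
          ← map_add, add_assoc]
        exact h1
      have h5 : G.orthogonalProjectionOnto (padZero n m (B (x₀ + x)) + y - s • κ) = 0 :=
        Submodule.orthogonalProjectionOnto_eq_zero_iff.2
          ((Submodule.mem_orthogonal _ _).2 horth)
      rw [map_sub, map_add, Submodule.orthogonalProjectionOnto_mem_subspace_eq_self, map_smul,
        sub_eq_zero] at h5
      simp only [← h5, neg_add_cancel_left]
    rw [hν, hν]
    calc lebesgueOn G (e' ⁻¹' {w : F₁ | ‖w‖ ≤ 1 ∧ x + w ∈ A})
        ≤ lebesgueOn G (s • (G.orthogonalProjectionOnto '' unitBall p)) := by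
          refine (measure_mono hsub).trans (le_of_eq ?_)
          rw [Set.image_add_left, measure_preimage_add]
      _ = ENNReal.ofReal (s ^ k) * lebesgueOn G (G.orthogonalProjectionOnto '' unitBall p) := by
          rw [Measure.addHaar_smul_of_nonneg _ hs.le, hG]
      _ ≤ ENNReal.ofReal (s ^ k) * (ENNReal.ofReal (volumeNumber k p ^ k) *
            lebesgueOn G (Metric.closedBall 0 1)) := by
          gcongr
          exact lebesgueOn_proj_le_volumeNumber hp hk G hG
      _ = ENNReal.ofReal ((2 * s * volumeNumber k p) ^ k) *
            lebesgueOn G (Metric.closedBall 0 (1 / 2)) := by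
          rw [Measure.addHaar_closedBall' _ _ (by norm_num : (0 : ℝ) ≤ 1 / 2), hG, ← mul_assoc, ← mul_assoc,
            ← ENNReal.ofReal_mul (by positivity), ← ENNReal.ofReal_mul
              (pow_nonneg (mul_nonneg (by positivity) volumeNumber_nonneg) _), ← mul_pow, ← mul_pow]
          congr 3
          ring
      _ ≤ _ := by gcongr
  have := measure_inter_closedBall_le_of_section volume F₁ ν hAo.measurableSet hsec
  refine le_trans (measure_mono ?_) this
  rintro v ⟨hv1, hv2⟩
  exact ⟨hv2, by simpa using hv1⟩

end SmallBall

/-! ### Gaussian measure and averaging over shifts. -/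

section Gaussian

theorem lintegral_pi_prod {E : Type*} [MeasurableSpace E] (μ : Measure E) [SigmaFinite μ]
    {m : ℕ} (f : Fin m → E → ENNReal) (hf : ∀ j, Measurable (f j)) :
    ∫⁻ g : Fin m → E, ∏ j, f j (g j) ∂(Measure.pi fun _ => μ) = ∏ j, ∫⁻ x, f j x ∂μ := by
  induction m with
  | zero => simp
  | succ m ih =>
    have e := (measurePreserving_piFinSuccAbove (fun _ : Fin (m + 1) => μ) 0).symm
    rw [← e.lintegral_comp_emb (MeasurableEquiv.measurableEmbedding _)]
    simp only [Fin.prod_univ_succ]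
    calc _ = ∫⁻ z : E × (Fin m → E), f 0 z.1 * ∏ j, f (Fin.succ j) (z.2 j)
          ∂(μ.prod (Measure.pi fun _ => μ)) := by
          refine lintegral_congr fun z => ?_
          simp [MeasurableEquiv.piFinSuccAbove, Fin.insertNthEquiv]
      _ = _ := by
          have hg : Measurable fun x : Fin m → E => ∏ j, f (Fin.succ j) (x j) :=
            Finset.measurable_prod _ fun j _ => (hf _).comp (measurable_pi_apply j)
          rw [lintegral_prod_mul (hf 0).aemeasurable hg.aemeasurable, ih _ fun j => hf _]

/-- The density of the Gaussian law. -/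
def gaussianDensity (n : ℕ) (x : Euc n) : ENNReal :=
  ENNReal.ofReal (((n : ℝ) / (2 * Real.pi)) ^ ((n : ℝ) / 2) * Real.exp (-(n * ‖x‖ ^ 2) / 2))

theorem measurable_gaussianDensity (n : ℕ) : Measurable (gaussianDensity n) := by
  unfold gaussianDensity; fun_prop

instance sigmaFinite_gaussianLaw (n : ℕ) : SigmaFinite (gaussianLaw n) :=
  SigmaFinite.withDensity_ofReal _

theorem pi_gaussianLaw (n m : ℕ) :
    Measure.pi (fun _ : Fin m => gaussianLaw n) =
      (volume : Measure (Fin m → Euc n)).withDensity fun g => ∏ j, gaussianDensity n (g j) := by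
  refine Measure.pi_eq fun s hs => ?_
  rw [withDensity_apply _ (MeasurableSet.univ_pi hs), ← lintegral_indicator (.univ_pi hs)]
  have h1 : ∀ g : Fin m → Euc n, (Set.univ.pi s).indicator
      (fun g => ∏ j, gaussianDensity n (g j)) g
        = ∏ j, (s j).indicator (gaussianDensity n) (g j) := by
    intro g
    by_cases hg : g ∈ Set.univ.pi s
    · rw [Set.indicator_of_mem hg]
      exact Finset.prod_congr rfl fun j _ => (Set.indicator_of_mem (hg j trivial) _).symm
    · rw [Set.indicator_of_notMem hg]
      simp only [Set.mem_pi, Set.mem_univ, true_imp_iff, not_forall] at hg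
      obtain ⟨j, hj⟩ := hg
      exact (Finset.prod_eq_zero (Finset.mem_univ j) (Set.indicator_of_notMem hj _)).symm
  simp_rw [h1]
  rw [volume_pi, lintegral_pi_prod volume _
    fun j => (measurable_gaussianDensity n).indicator (hs j)]
  refine Finset.prod_congr rfl fun j _ => ?_
  rw [lintegral_indicator (hs j), gaussianLaw, withDensity_apply _ (hs j)]
  rfl

/-- A multiple of a wider Gaussian density, which dominates the Gaussian density under
translations of length at most one. -/
def wideDensity (n : ℕ) (x : Euc n) : ENNReal :=
  ENNReal.ofReal (((n : ℝ) / (2 * Real.pi)) ^ ((n : ℝ) / 2) * Real.exp (n / 2) *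
    Real.exp (-(n * ‖x‖ ^ 2) / 4))

theorem measurable_wideDensity (n : ℕ) : Measurable (wideDensity n) := by
  unfold wideDensity; fun_prop

theorem gaussianDensity_add_le {n : ℕ} (x v : Euc n) (hv : ‖v‖ ≤ 1) :
    gaussianDensity n (x + v) ≤ wideDensity n x := by
  refine ENNReal.ofReal_le_ofReal ?_
  rw [mul_assoc, ← Real.exp_add]
  refine mul_le_mul_of_nonneg_left (Real.exp_le_exp.2 ?_) (by positivity)
  have h1 : ‖x‖ ≤ ‖x + v‖ + 1 := by
    have := norm_sub_le (x + v) v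
    rw [add_sub_cancel_right] at this
    linarith
  have h2 : ‖x‖ ^ 2 ≤ 2 * ‖x + v‖ ^ 2 + 2 := by
    nlinarith [norm_nonneg x, sq_nonneg (‖x + v‖ - 1), norm_nonneg (x + v)]
  have h3 : (0 : ℝ) ≤ n := n.cast_nonneg
  nlinarith

theorem two_add_pow_le {n k : ℕ} (hkn : k ≤ n) {x : ℝ} (hx : 0 ≤ x) :
    (2 + x) ^ k ≤ 3 ^ n * Real.exp (n * x ^ 2 / 8) := by
  have h1 : 2 + x ≤ 3 * Real.exp (x ^ 2 / 8) := by
    have := Real.add_one_le_exp (x ^ 2 / 8)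
    nlinarith [sq_nonneg (3 * x - 4)]
  calc (2 + x) ^ k ≤ (2 + x) ^ n := pow_le_pow_right₀ (by linarith) hkn
    _ ≤ (3 * Real.exp (x ^ 2 / 8)) ^ n := by gcongr
    _ = _ := by rw [mul_pow, ← Real.exp_nat_mul]; ring_nf

/-- The polynomial uses half of the exponent `n‖x‖²/4`. The remaining Gaussian integral gives `2^n`,
and `e^{n/2} ≤ (5/3)^n`; so `10 = 2 · (5/3) · 3`. -/
theorem lintegral_wideDensity_mul_le {n k : ℕ} (hn : 0 < n) (hkn : k ≤ n) :
    ∫⁻ x : Euc n, wideDensity n x * ENNReal.ofReal ((2 + ‖x‖) ^ k) ≤ 10 ^ n := by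
  have hn' : (0 : ℝ) < n := by exact_mod_cast hn
  set C : ℝ := ((n : ℝ) / (2 * Real.pi)) ^ ((n : ℝ) / 2) with hC
  have hCpos : 0 < C := by positivity
  have hI := GaussianFourier.integral_rexp_neg_mul_sq_norm (V := Euc n)
    (b := n / 8) (by positivity)
  rw [finrank_euclideanSpace_fin] at hI
  have hIpos : 0 < (Real.pi / ((n : ℝ) / 8)) ^ ((n : ℝ) / 2) := by positivity
  have hint : Integrable fun x : Euc n => Real.exp (-(n / 8) * ‖x‖ ^ 2) := by
    by_contra hcon
    rw [integral_undef hcon] at hI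
    exact hIpos.ne hI
  calc ∫⁻ x : Euc n, wideDensity n x * ENNReal.ofReal ((2 + ‖x‖) ^ k)
      ≤ ∫⁻ x : Euc n, ENNReal.ofReal (C * Real.exp (n / 2) * 3 ^ n) *
          ENNReal.ofReal (Real.exp (-(n / 8) * ‖x‖ ^ 2)) := by
        refine lintegral_mono fun x => ?_
        rw [wideDensity, ← ENNReal.ofReal_mul (by positivity),
          ← ENNReal.ofReal_mul (by positivity)]
        refine ENNReal.ofReal_le_ofReal ?_
        calc C * Real.exp (n / 2) * Real.exp (-(n * ‖x‖ ^ 2) / 4) * (2 + ‖x‖) ^ k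
            ≤ C * Real.exp (n / 2) * Real.exp (-(n * ‖x‖ ^ 2) / 4) *
              (3 ^ n * Real.exp (n * ‖x‖ ^ 2 / 8)) := by
              gcongr
              exact two_add_pow_le hkn (norm_nonneg x)
          _ = C * Real.exp (n / 2) * 3 ^ n *
              (Real.exp (-(n * ‖x‖ ^ 2) / 4) * Real.exp (n * ‖x‖ ^ 2 / 8)) := by ring
          _ = _ := by rw [← Real.exp_add]; ring_nf
    _ = ENNReal.ofReal (C * Real.exp (n / 2) * 3 ^ n *
          (Real.pi / ((n : ℝ) / 8)) ^ ((n : ℝ) / 2)) := by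
        rw [lintegral_const_mul _ (by fun_prop),
          ← ofReal_integral_eq_lintegral_ofReal hint
            (Filter.Eventually.of_forall fun x => (Real.exp_pos _).le), hI,
          ← ENNReal.ofReal_mul (by positivity)]
    _ ≤ ENNReal.ofReal (10 ^ n) := by
        refine ENNReal.ofReal_le_ofReal ?_
        have h1 : C * (Real.pi / ((n : ℝ) / 8)) ^ ((n : ℝ) / 2) = 2 ^ n := by
          rw [hC, ← Real.mul_rpow (by positivity) (by positivity)]
          have : (n : ℝ) / (2 * Real.pi) * (Real.pi / ((n : ℝ) / 8)) = 2 ^ (2 : ℝ) := by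
            have := Real.pi_pos.ne'
            field_simp
            norm_num
          rw [this, ← Real.rpow_mul (by norm_num), mul_div_cancel₀ _ (by norm_num),
            Real.rpow_natCast]
        have h2 : Real.exp (n / 2) ≤ (5 / 3) ^ n := by
          have h3 : Real.exp (1 / 2) ≤ 5 / 3 := by
            refine abs_le_of_sq_le_sq' ?_ (by norm_num) |>.2
            rw [← Real.exp_nat_mul]
            norm_num
            linarith [Real.exp_one_lt_d9]
          calc Real.exp (n / 2) = Real.exp (1 / 2) ^ n := by
                rw [← Real.exp_nat_mul]; ring_nf
            _ ≤ _ := by gcongr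
        calc C * Real.exp (n / 2) * 3 ^ n * (Real.pi / ((n : ℝ) / 8)) ^ ((n : ℝ) / 2)
            = 2 ^ n * Real.exp (n / 2) * 3 ^ n := by rw [← h1]; ring
          _ ≤ 2 ^ n * (5 / 3) ^ n * 3 ^ n := by gcongr
          _ = 10 ^ n := by rw [← mul_pow, ← mul_pow]; norm_num
    _ = _ := by rw [ENNReal.ofReal_pow (by norm_num)]; norm_num

/-- If the fibres of `A` along `Fᵐ` have a small proportion of the unit ball of `Fᵐ`, then `A` has
small Gaussian measure. -/
theorem pi_gaussianLaw_le_of_section {n m k : ℕ} (hn : 0 < n) (hkn : k ≤ n)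
    (F : Submodule ℝ (Euc n)) {A : Set (Fin m → Euc n)} (hA : MeasurableSet A) {κ : ENNReal}
    (h : ∀ g : Fin m → Euc n, ∃ D : Fin m → Set F,
      (∀ v : Fin m → F, (∀ j, ‖v j‖ ≤ 1) → (fun j => g j + v j) ∈ A → ∀ j, v j ∈ D j) ∧
      ∀ j, volume (D j) ≤ ENNReal.ofReal ((2 + ‖g j‖) ^ k) *
        (κ * volume (Metric.closedBall (0 : F) 1))) :
    Measure.pi (fun _ : Fin m => gaussianLaw n) A ≤ (10 ^ n * κ) ^ m := by
  set β := volume (Metric.closedBall (0 : F) 1) with hβ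
  have hβ0 : β ≠ 0 := (Metric.measure_closedBall_pos volume 0 one_pos).ne'
  have hβt : β ≠ ⊤ := measure_closedBall_lt_top.ne
  set Q : Set (Fin m → F) := Set.univ.pi fun _ => Metric.closedBall 0 1 with hQ
  have hQm : MeasurableSet Q := .univ_pi fun _ => Metric.isClosed_closedBall.measurableSet
  have hQv : volume Q = β ^ m := by
    rw [hQ, volume_pi_pi]; simp [hβ]
  have hQmem : ∀ v ∈ Q, ∀ j, ‖v j‖ ≤ 1 := fun v hv j => by
    simpa using hv j trivial
  let sh : (Fin m → F) → (Fin m → Euc n) := fun v j => v j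
  have hsh : Measurable sh := by fun_prop
  have hψ : Measurable fun g : Fin m → Euc n => ∏ j, gaussianDensity n (g j) :=
    Finset.measurable_prod _ fun j _ =>
      (measurable_gaussianDensity n).comp (measurable_pi_apply j)
  have hψ' : Measurable fun g : Fin m → Euc n => ∏ j, wideDensity n (g j) :=
    Finset.measurable_prod _ fun j _ => (measurable_wideDensity n).comp (measurable_pi_apply j)
  have hind : Measurable fun q : (Fin m → F) × (Fin m → Euc n) =>
      A.indicator (1 : (Fin m → Euc n) → ENNReal) (q.2 + sh q.1) :=
    (measurable_one.indicator hA).comp (measurable_snd.add (hsh.comp measurable_fst))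
  have h1 : ∀ v : Fin m → F, Measure.pi (fun _ : Fin m => gaussianLaw n) A =
      ∫⁻ g : Fin m → Euc n, (∏ j, gaussianDensity n ((g + sh v) j)) *
        A.indicator 1 (g + sh v) := by
    intro v
    rw [lintegral_add_right_eq_self (μ := (volume : Measure (Fin m → Euc n)))
      (fun g => (∏ j, gaussianDensity n (g j)) * A.indicator 1 g), pi_gaussianLaw,
      withDensity_apply _ hA, ← lintegral_indicator hA]
    refine lintegral_congr fun g => ?_
    by_cases hg : g ∈ A <;> simp [hg]
  -- Integrating the constant probability over shifts `v` in a product of unit balls makes one wide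
  -- density serve all shifts. After exchanging integrals, the inner measure is bounded by a product
  -- over `j`.
  have h2 : Measure.pi (fun _ : Fin m => gaussianLaw n) A * β ^ m ≤ (10 ^ n * κ * β) ^ m := by
    calc _ = ∫⁻ _v in Q, Measure.pi (fun _ : Fin m => gaussianLaw n) A := by
          rw [setLIntegral_const, hQv]
      _ ≤ ∫⁻ v in Q, ∫⁻ g : Fin m → Euc n, (∏ j, wideDensity n (g j)) *
            A.indicator 1 (g + sh v) := by
          refine setLIntegral_mono' hQm fun v hv => ?_
          rw [h1 v]
          refine lintegral_mono fun g => ?_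
          gcongr with j
          exact gaussianDensity_add_le _ _ (hQmem v hv j)
      _ = ∫⁻ g : Fin m → Euc n, ∫⁻ v in Q, (∏ j, wideDensity n (g j)) *
            A.indicator 1 (g + sh v) :=
          lintegral_lintegral_swap ((hψ'.comp measurable_snd).mul hind).aemeasurable
      _ ≤ ∫⁻ g : Fin m → Euc n, ∏ j, (wideDensity n (g j) *
            (ENNReal.ofReal ((2 + ‖g j‖) ^ k) * (κ * β))) := by
          refine lintegral_mono fun g => ?_
          have hg : Measurable fun v : Fin m → F =>
              A.indicator (1 : (Fin m → Euc n) → ENNReal) (g + sh v) :=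
            hind.comp (measurable_id.prodMk measurable_const)
          obtain ⟨D, hD1, hD2⟩ := h g
          have hm : MeasurableSet {v : Fin m → F | g + sh v ∈ A} :=
            (measurable_const.add hsh) hA
          have hi : ∀ v : Fin m → F, A.indicator (1 : (Fin m → Euc n) → ENNReal) (g + sh v) =
            {v : Fin m → F | g + sh v ∈ A}.indicator 1 v := fun v => rfl
          simp only
          rw [lintegral_const_mul _ hg, Finset.prod_mul_distrib]
          gcongr
          simp_rw [hi]
          rw [lintegral_indicator_one hm, Measure.restrict_apply hm]
          calc volume ({v : Fin m → F | g + sh v ∈ A} ∩ Q) ≤ volume (Set.univ.pi D) :=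
                measure_mono fun v hv j _ => hD1 v (hQmem v hv.2) hv.1 j
            _ = ∏ j, volume (D j) := volume_pi_pi _
            _ ≤ _ := Finset.prod_le_prod' fun j _ => hD2 j
      _ = ∏ _j : Fin m, ∫⁻ x : Euc n, wideDensity n x *
            (ENNReal.ofReal ((2 + ‖x‖) ^ k) * (κ * β)) := by
          rw [volume_pi]
          refine lintegral_pi_prod volume (fun _ x => wideDensity n x *
            (ENNReal.ofReal ((2 + ‖x‖) ^ k) * (κ * β))) fun j => ?_
          exact (measurable_wideDensity n).mul (by fun_prop)
      _ ≤ ∏ _j : Fin m, 10 ^ n * κ * β := by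
          refine Finset.prod_le_prod' fun j _ => ?_
          simp_rw [← mul_assoc]
          have hm : Measurable fun x : Euc n =>
              wideDensity n x * ENNReal.ofReal ((2 + ‖x‖) ^ k) :=
            (measurable_wideDensity n).mul (by fun_prop)
          rw [lintegral_mul_const _ (hm.mul_const _), lintegral_mul_const _ hm]
          gcongr
          exact lintegral_wideDensity_mul_le hn hkn
      _ = _ := by simp
  rw [mul_pow _ β] at h2
  exact (ENNReal.mul_le_mul_iff_left (pow_ne_zero _ hβ0) (ENNReal.pow_ne_top hβt)).1 h2

end Gaussian

/-! ### Probability of the trap event. -/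

section Trap

variable {n m k : ℕ} {p : Seminorm ℝ (Euc (n + m))}

/-- The span of the components `u_j` of the `g_j` orthogonal to `F`, and of their images `B u_j`. -/
def residualSpan (B : Euc n →ₗ[ℝ] Euc n) (F : Submodule ℝ (Euc n)) (g : Fin m → Euc n) :
    Submodule ℝ (Euc n) :=
  Submodule.span ℝ (Set.range fun j => Fᗮ.starProjection (g j)) ⊔
    Submodule.span ℝ (Set.range fun j => B (Fᗮ.starProjection (g j)))

theorem finrank_residualSpan_le (B : Euc n →ₗ[ℝ] Euc n) (F : Submodule ℝ (Euc n))
    (g : Fin m → Euc n) : Module.finrank ℝ (residualSpan B F g) ≤ 2 * m := by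
  have h1 := finrank_range_le_card (R := ℝ) fun j => Fᗮ.starProjection (g j)
  have h2 := finrank_range_le_card (R := ℝ) fun j => B (Fᗮ.starProjection (g j))
  have h3 := Submodule.finrank_add_le_finrank_add_finrank
    (Submodule.span ℝ (Set.range fun j => Fᗮ.starProjection (g j)))
    (Submodule.span ℝ (Set.range fun j => B (Fᗮ.starProjection (g j))))
  rw [Fintype.card_fin] at h1 h2
  unfold Set.finrank at h1 h2
  unfold residualSpan
  omega

/-- Shifts along `F` leave the trapping subspace fixed, so for given `g` the conditions on the
different `v_j` decouple. -/
theorem residualSpan_add (B : Euc n →ₗ[ℝ] Euc n) (F : Submodule ℝ (Euc n)) (g : Fin m → Euc n)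
    (v : Fin m → F) : residualSpan B F (fun j => g j + v j) = residualSpan B F g := by
  have h : ∀ j, Fᗮ.starProjection (g j + v j) = Fᗮ.starProjection (g j) := fun j => by
    rw [map_add, (Submodule.starProjection_apply_eq_zero_iff Fᗮ).2
      (F.le_orthogonal_orthogonal (v j).2), add_zero]
  simp only [residualSpan, h]

/-- The event that the `B g_j` lie in suitable multiples of the projection of `B_E`, up to vectors
of `F`, of `H` and of the residual span. -/
def trapEvent (p : Seminorm ℝ (Euc (n + m))) (s : ℝ) (B : Euc n →ₗ[ℝ] Euc n)
    (F H : Submodule ℝ (Euc n)) : Set (Fin m → Euc n) :=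
  {g | ∀ j, ∃ κ, p κ < 1 ∧
    B (g j) - (s * (1 + ‖g j‖)) • firstCoords n m κ ∈ F ⊔ (H ⊔ residualSpan B F g)}

/-- The residual span moves with `g`. With the coefficients of its generators frozen, each condition
is open in `g`, and the event is a union over coefficients. -/
theorem isOpen_trapEvent (hc : Continuous p) {s : ℝ} (hs : 0 < s) (B : Euc n →ₗ[ℝ] Euc n)
    (F H : Submodule ℝ (Euc n)) : IsOpen (trapEvent p s B F H) := by
  have hU : IsOpen ((firstCoords n m) '' {κ | p κ < 1}) :=
    (firstCoords n m).isOpenMap_of_finiteDimensional (fun x => ⟨_, firstCoords_padZero x⟩) _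
      (isOpen_lt hc continuous_const)
  have hBc : Continuous B := B.continuous_of_finiteDimensional
  have hj : ∀ j, IsOpen {g : Fin m → Euc n | ∃ κ, p κ < 1 ∧
      B (g j) - (s * (1 + ‖g j‖)) • firstCoords n m κ ∈ F ⊔ (H ⊔ residualSpan B F g)} := by
    intro j
    let f : (Euc n × (Fin m → ℝ) × (Fin m → ℝ)) → (Fin m → Euc n) → Euc n := fun q g =>
      (s * (1 + ‖g j‖))⁻¹ • (B (g j) - (q.1 + (∑ i, q.2.1 i • Fᗮ.starProjection (g i) +
        ∑ i, q.2.2 i • B (Fᗮ.starProjection (g i)))))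
    have hpos : ∀ g : Fin m → Euc n, 0 < s * (1 + ‖g j‖) := fun g => by positivity
    have hf : ∀ q, Continuous (f q) := by
      intro q
      refine Continuous.smul (Continuous.inv₀ (by fun_prop) fun g => (hpos g).ne') ?_
      fun_prop
    have heq : {g : Fin m → Euc n | ∃ κ, p κ < 1 ∧
        B (g j) - (s * (1 + ‖g j‖)) • firstCoords n m κ ∈ F ⊔ (H ⊔ residualSpan B F g)} =
        ⋃ q ∈ {q : Euc n × (Fin m → ℝ) × (Fin m → ℝ) | q.1 ∈ F ⊔ H},
          f q ⁻¹' ((firstCoords n m) '' {κ | p κ < 1}) := by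
      ext g
      simp only [Set.mem_ofPred_eq, Set.mem_iUnion, Set.mem_preimage, Set.mem_image, exists_prop]
      rw [← sup_assoc]
      constructor
      · rintro ⟨κ, hκ, hmem⟩
        obtain ⟨y, hy, z, hz, hyz⟩ := Submodule.mem_sup.1 hmem
        obtain ⟨z₁, hz₁, z₂, hz₂, rfl⟩ := Submodule.mem_sup.1 hz
        obtain ⟨c₁, rfl⟩ := (Submodule.mem_span_range_iff_exists_fun ℝ).1 hz₁
        obtain ⟨c₂, rfl⟩ := (Submodule.mem_span_range_iff_exists_fun ℝ).1 hz₂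
        refine ⟨(y, c₁, c₂), hy, κ, hκ, ?_⟩
        simp only [f]
        rw [hyz, sub_sub_cancel, inv_smul_smul₀ (hpos g).ne']
      · rintro ⟨⟨y, c₁, c₂⟩, hy, κ, hκ, h⟩
        refine ⟨κ, hκ, Submodule.mem_sup.2 ⟨y, hy, _, Submodule.add_mem_sup
          ((Submodule.mem_span_range_iff_exists_fun ℝ).2 ⟨c₁, rfl⟩)
          ((Submodule.mem_span_range_iff_exists_fun ℝ).2 ⟨c₂, rfl⟩), ?_⟩⟩
        rw [h]
        simp only [f]
        rw [smul_inv_smul₀ (hpos g).ne', sub_sub_cancel]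
    rw [heq]
    exact isOpen_biUnion fun q _ => hU.preimage (hf q)
  have : trapEvent p s B F H = ⋂ j, {g : Fin m → Euc n | ∃ κ, p κ < 1 ∧
      B (g j) - (s * (1 + ‖g j‖)) • firstCoords n m κ ∈ F ⊔ (H ⊔ residualSpan B F g)} := by
    ext g; simp [trapEvent]
  rw [this]
  exact isOpen_iInter_of_finite hj

theorem pi_gaussianLaw_trapEvent_le (hp : unitBall p ⊆ euclBall (n + m)) (hc : Continuous p)
    (hn : 0 < n) (hk : 1 ≤ k) (hkn : k ≤ n) {s : ℝ} (hs : 0 < s) (B : Euc n →ₗ[ℝ] Euc n)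
    (F H : Submodule ℝ (Euc n)) (hB : ∀ x ∈ F, ‖x‖ ≤ 2 * ‖Fᗮ.starProjection (B x)‖)
    (hF : Module.finrank ℝ H + 2 * m + k ≤ Module.finrank ℝ F) :
    Measure.pi (fun _ : Fin m => gaussianLaw n) (trapEvent p s B F H) ≤
      ENNReal.ofReal ((20 ^ n * (2 * s * volumeNumber k p) ^ k) ^ m) := by
  have hV : 0 ≤ volumeNumber k p := volumeNumber_nonneg
  have key := pi_gaussianLaw_le_of_section hn hkn F (isOpen_trapEvent hc hs B F H).measurableSet
    (κ := ENNReal.ofReal (2 ^ n * (2 * s * volumeNumber k p) ^ k)) fun g => by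
      let Y := H ⊔ residualSpan B F g
      refine ⟨fun j => {v : F | ‖v‖ ≤ 1 ∧ ∃ κ, p κ < 1 ∧
        B (g j + v) - (s * (2 + ‖g j‖)) • firstCoords n m κ ∈ F ⊔ Y}, ?_, ?_⟩
      · intro v hv hmem j
        obtain ⟨κ, hκ, h⟩ := hmem j
        rw [residualSpan_add] at h
        have hpos : 0 < 2 + ‖g j‖ := by positivity
        have hle : 1 + ‖g j + v j‖ ≤ 2 + ‖g j‖ := by
          have := norm_add_le (g j) (v j : Euc n)
          have h2 : ‖(v j : Euc n)‖ ≤ 1 := hv j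
          linarith
        have hq0 : 0 ≤ (1 + ‖g j + v j‖) / (2 + ‖g j‖) := by positivity
        -- The radius depends on the shifted vector; shrinking `κ` replaces it by the larger radius
        -- `s (2 + ‖g_j‖)`, independent of `v`.
        refine ⟨hv j, ((1 + ‖g j + v j‖) / (2 + ‖g j‖)) • κ, ?_, ?_⟩
        · rw [map_smul_eq_mul, Real.norm_of_nonneg hq0]
          exact (mul_le_of_le_one_left (apply_nonneg p κ)
            (div_le_one_of_le₀ hle hpos.le)).trans_lt hκ
        · rw [map_smul, smul_smul]
          convert h using 3
          field_simp
      · intro j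
        have hY : Module.finrank ℝ Y + k ≤ Module.finrank ℝ F := by
          have h1 := Submodule.finrank_add_le_finrank_add_finrank H (residualSpan B F g)
          have h2 := finrank_residualSpan_le B F g
          simp only [Y]; omega
        refine (volume_trapped_le hp hc hk F Y B hB hY (g j)
          (s := s * (2 + ‖g j‖)) (by positivity)).trans ?_
        rw [← mul_assoc (ENNReal.ofReal ((2 + ‖g j‖) ^ k))]
        refine mul_le_mul' ?_ le_rfl
        have hFn : Module.finrank ℝ F ≤ n := by
          simpa using Submodule.finrank_le F
        calc (2 : ENNReal) ^ Module.finrank ℝ F *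
              ENNReal.ofReal ((2 * (s * (2 + ‖g j‖)) * volumeNumber k p) ^ k)
            ≤ 2 ^ n * ENNReal.ofReal ((2 * (s * (2 + ‖g j‖)) * volumeNumber k p) ^ k) :=
              mul_le_mul' (pow_le_pow_right₀ one_le_two hFn) le_rfl
          _ = ENNReal.ofReal (2 ^ n) *
              ENNReal.ofReal ((2 * (s * (2 + ‖g j‖)) * volumeNumber k p) ^ k) := by
              rw [ENNReal.ofReal_pow zero_le_two, ENNReal.ofReal_ofNat]
          _ = _ := by
              rw [← ENNReal.ofReal_mul (by positivity),
                ← ENNReal.ofReal_mul (pow_nonneg (by positivity) _)]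
              congr 1
              simp only [mul_pow]; ring
  refine key.trans (le_of_eq ?_)
  have h10 : (10 : ENNReal) ^ n = ENNReal.ofReal (10 ^ n) := by
    rw [ENNReal.ofReal_pow (by norm_num)]; norm_num
  rw [h10, ← ENNReal.ofReal_mul (by positivity), ← ENNReal.ofReal_pow (by positivity)]
  congr 2
  rw [← mul_assoc, ← mul_pow]
  norm_num

end Trap

/-! ### Compressed norms, lifts of vertices and measurability. -/

section CompressedNorm

variable {n m : ℕ} {p : Seminorm ℝ (Euc (n + m))} {a : ℝ}

theorem quotientMap_padZero (g : Fin m → Euc n) (x : Euc n) :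
    quotientMap g (padZero n m x) = x := by
  simp [quotientMap_apply, firstCoords_padZero]

theorem continuous_quotientMap (x : Euc (n + m)) :
    Continuous fun g : Fin m → Euc n => quotientMap g x := by
  simp only [quotientMap_apply]
  fun_prop

theorem projWithKer_eq_iff (H : Submodule ℝ (Euc n)) (x y : Euc n) :
    projWithKer H x = projWithKer H y ↔ x - y ∈ H := by
  rw [← sub_eq_zero, ← map_sub]
  show Hᗮ.starProjection (x - y) = 0 ↔ _
  rw [Submodule.starProjection_apply_eq_zero_iff, Submodule.orthogonal_orthogonal]

theorem projWithKer_projWithKer (H : Submodule ℝ (Euc n)) (x : Euc n) :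
    projWithKer H (projWithKer H x) = projWithKer H x :=
  Submodule.starProjection_eq_self_iff.2 (Hᗮ.starProjection_apply_mem x)

theorem quotientNorm_le {N : ℕ} {q : Euc N → ℝ} (hq : ∀ x, 0 ≤ q x) (Q : Euc N →ₗ[ℝ] Euc n)
    {x : Euc N} {y : Euc n} (h : Q x = y) : quotientNorm q Q y ≤ q x :=
  csInf_le ⟨0, by rintro _ ⟨x, -, rfl⟩; exact hq x⟩ ⟨x, h, rfl⟩

theorem l1Norm_nonneg {N : ℕ} (x : Euc N) : 0 ≤ l1Norm x :=
  Finset.sum_nonneg fun _ _ => abs_nonneg _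

theorem norm_le_l1Norm {N : ℕ} (x : Euc N) : ‖x‖ ≤ l1Norm x := by
  conv_lhs => rw [← (EuclideanSpace.basisFun (Fin N) ℝ).sum_repr x]
  refine (norm_sum_le _ _).trans (le_of_eq ?_)
  simp [l1Norm, norm_smul]

theorem exists_of_compressedNorm_lt (ha : 0 < a)
    (hp : ∀ x ∈ euclBall (n + m), a • x ∈ unitBall p) {g : Fin m → Euc n}
    {T : Euc n →ₗ[ℝ] Euc n} {H : Submodule ℝ (Euc n)} {r : ℝ} (hr : compressedNorm p g T H < r) :
    ∃ t, 0 ≤ t ∧ t < r ∧ ∀ i, ∃ x, p x ≤ t ∧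
      T (quotientMap g (EuclideanSpace.single i 1)) - quotientMap g x ∈ H := by
  set Q := quotientMap g with hQ
  let T' := T.toContinuousLinearMap
  let Q' := Q.toContinuousLinearMap
  have hsurj : ∀ y, projWithKer H (Q (padZero n m (projWithKer H y))) = projWithKer H y :=
    fun y => by rw [hQ, quotientMap_padZero, projWithKer_projWithKer]
  -- The infimum of an empty set of reals would be zero, so a finite bound must be exhibited before
  -- a small norm means anything.
  have hne : Set.Nonempty {t : ℝ | 0 ≤ t ∧ ∀ x, quotientNorm p (projWithKer H ∘ₗ Q)
      ((projWithKer H ∘ₗ T) x) ≤ t * quotientNorm l1Norm Q x} := by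
    refine ⟨a⁻¹ * ‖T'‖ * ‖Q'‖, by positivity, fun x => ?_⟩
    have h1 : quotientNorm p (projWithKer H ∘ₗ Q) ((projWithKer H ∘ₗ T) x)
        ≤ a⁻¹ * (‖T'‖ * ‖x‖) := by
      refine (quotientNorm_le (apply_nonneg p) _ (hsurj (T x))).trans ?_
      refine (seminorm_le ha hp _).trans ?_
      rw [norm_padZero]
      gcongr
      exact (Hᗮ.norm_starProjection_apply_le (T x)).trans (T'.le_opNorm x)
    have h2 : ‖x‖ ≤ ‖Q'‖ * quotientNorm l1Norm Q x := by
      refine le_of_forall_pos_le_add fun ε hε => ?_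
      have hδ : 0 < ε / (‖Q'‖ + 1) := by positivity
      have hn : (l1Norm '' {z | Q z = x}).Nonempty :=
        ⟨_, _, quotientMap_padZero g x, rfl⟩
      obtain ⟨_, ⟨z, hz, rfl⟩, hlt⟩ := exists_lt_of_csInf_lt hn
        (lt_add_of_pos_right (quotientNorm l1Norm Q x) hδ)
      have hz' : Q' z = x := hz
      have hε' : ‖Q'‖ * (ε / (‖Q'‖ + 1)) ≤ ε := by
        rw [mul_div_assoc', div_le_iff₀ (by positivity)]
        nlinarith [norm_nonneg Q']
      calc ‖x‖ ≤ ‖Q'‖ * ‖z‖ := by rw [← hz']; exact Q'.le_opNorm z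
        _ ≤ ‖Q'‖ * (quotientNorm l1Norm Q x + ε / (‖Q'‖ + 1)) := by
            gcongr
            exact (norm_le_l1Norm z).trans hlt.le
        _ ≤ _ := by rw [mul_add]; linarith
    calc _ ≤ a⁻¹ * (‖T'‖ * ‖x‖) := h1
      _ ≤ a⁻¹ * (‖T'‖ * (‖Q'‖ * quotientNorm l1Norm Q x)) := by gcongr
      _ = _ := by ring
  obtain ⟨t, ⟨ht0, ht⟩, htr⟩ := exists_lt_of_csInf_lt hne hr
  -- Passing to the midpoint leaves room for quotient norms that are not attained.
  refine ⟨(t + r) / 2, by linarith, by linarith, fun i => ?_⟩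
  have h1 := ht (Q (EuclideanSpace.single i 1))
  have h2 : quotientNorm l1Norm Q (Q (EuclideanSpace.single i 1)) ≤ 1 := by
    refine (quotientNorm_le l1Norm_nonneg Q rfl).trans (le_of_eq ?_)
    rw [l1Norm, Finset.sum_eq_single i] <;> simp +contextual
  have h3 : quotientNorm p (projWithKer H ∘ₗ Q)
      ((projWithKer H ∘ₗ T) (Q (EuclideanSpace.single i 1))) < (t + r) / 2 := by
    have : t * quotientNorm l1Norm Q (Q (EuclideanSpace.single i 1)) ≤ t :=
      mul_le_of_le_one_right ht0 h2
    linarith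
  have hn : (p '' {x | (projWithKer H ∘ₗ Q) x =
      (projWithKer H ∘ₗ T) (Q (EuclideanSpace.single i 1))}).Nonempty :=
    ⟨_, _, hsurj (T (Q (EuclideanSpace.single i 1))), rfl⟩
  obtain ⟨_, ⟨x, hx, rfl⟩, hlt⟩ := exists_lt_of_csInf_lt hn h3
  exact ⟨x, hlt.le, (projWithKer_eq_iff H _ _).1 (Eq.symm hx)⟩

theorem compressedNorm_le {g : Fin m → Euc n} {T : Euc n →ₗ[ℝ] Euc n}
    {H : Submodule ℝ (Euc n)} {t : ℝ} (ht : 0 ≤ t) (h : ∀ i, ∃ x, p x ≤ t ∧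
      T (quotientMap g (EuclideanSpace.single i 1)) - quotientMap g x ∈ H) :
    compressedNorm p g T H ≤ t := by
  choose x hx hxH using h
  set Q := quotientMap g with hQ
  refine csInf_le ⟨0, fun _ hs => hs.1⟩ ⟨ht, fun y => ?_⟩
  have key : ∀ z, Q z = y → quotientNorm p (projWithKer H ∘ₗ Q) ((projWithKer H ∘ₗ T) y)
      ≤ t * l1Norm z := by
    rintro z rfl
    have hX : (projWithKer H ∘ₗ Q) (∑ i, z i • x i) = (projWithKer H ∘ₗ T) (Q z) := by
      have hz : Q z = ∑ i, z i • Q (EuclideanSpace.single i 1) := map_eq_sum_single Q z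
      rw [hz, map_sum, map_sum]
      refine Finset.sum_congr rfl fun i _ => ?_
      rw [map_smul, map_smul]
      congr 1
      exact ((projWithKer_eq_iff H _ _).2 (hxH i)).symm
    refine (quotientNorm_le (apply_nonneg p) _ hX).trans ?_
    refine (Finset.le_sum_of_subadditive p (map_zero p).le (map_add_le_add p) _ _).trans ?_
    rw [l1Norm, Finset.mul_sum]
    refine Finset.sum_le_sum fun i _ => ?_
    rw [map_smul_eq_mul, Real.norm_eq_abs, mul_comm]
    gcongr
    exact hx i
  refine le_of_forall_pos_le_add fun ε hε => ?_
  have hδ : 0 < ε / (t + 1) := by positivity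
  have hn : (l1Norm '' {z | Q z = y}).Nonempty := ⟨_, _, quotientMap_padZero g y, rfl⟩
  obtain ⟨_, ⟨z, hz, rfl⟩, hlt⟩ := exists_lt_of_csInf_lt hn
    (lt_add_of_pos_right (quotientNorm l1Norm Q y) hδ)
  have hε' : t * (ε / (t + 1)) ≤ ε := by
    rw [mul_div_assoc', div_le_iff₀ (by positivity)]
    nlinarith
  calc _ ≤ t * l1Norm z := key z hz
    _ ≤ t * (quotientNorm l1Norm Q y + ε / (t + 1)) := by gcongr
    _ ≤ _ := by rw [mul_add]; linarith

/-- For nearby `g` the old lifts are corrected by padded vectors `δ i g`, which are small in `p`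
because `p ≤ a⁻¹‖·‖`. -/
theorem isOpen_compressedNorm_lt (ha : 0 < a)
    (hp : ∀ x ∈ euclBall (n + m), a • x ∈ unitBall p) (T : Euc n →ₗ[ℝ] Euc n)
    (H : Submodule ℝ (Euc n)) (r : ℝ) :
    IsOpen {g : Fin m → Euc n | compressedNorm p g T H < r} := by
  rw [isOpen_iff_mem_nhds]
  intro g₀ hg₀
  obtain ⟨t, ht0, htr, h⟩ := exists_of_compressedNorm_lt ha hp hg₀
  choose x hx hxH using h
  let δ : Fin (n + m) → (Fin m → Euc n) → Euc n := fun i g =>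
    T (quotientMap g (EuclideanSpace.single i 1) - quotientMap g₀ (EuclideanSpace.single i 1)) -
      (quotientMap g (x i) - quotientMap g₀ (x i))
  have hδ : ∀ i, Continuous (δ i) := fun i =>
    (T.continuous_of_finiteDimensional.comp
      ((continuous_quotientMap _).sub continuous_const)).sub
      ((continuous_quotientMap _).sub continuous_const)
  have hev : ∀ i, ∀ᶠ g in nhds g₀, ‖δ i g‖ < a * ((r - t) / 2) := by
    intro i
    have h0 : ‖δ i g₀‖ < a * ((r - t) / 2) := by
      have : δ i g₀ = 0 := by simp [δ]
      rw [this, norm_zero]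
      have : 0 < r - t := sub_pos.2 htr
      positivity
    exact (hδ i).norm.continuousAt.eventually_lt continuousAt_const h0
  filter_upwards [Filter.eventually_all.2 hev] with g hg
  have : compressedNorm p g T H ≤ (t + r) / 2 := by
    refine compressedNorm_le (by linarith) fun i =>
      ⟨x i + padZero n m (δ i g), ?_, ?_⟩
    · have h1 : p (padZero n m (δ i g)) ≤ (r - t) / 2 := by
        refine (seminorm_le ha hp _).trans ?_
        rw [norm_padZero, inv_mul_le_iff₀ ha]
        exact (hg i).le
      linarith [map_add_le_add p (x i) (padZero n m (δ i g)), hx i]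
    · rw [map_add, quotientMap_padZero]
      have e : T (quotientMap g (EuclideanSpace.single i 1)) - (quotientMap g (x i) + δ i g) =
          T (quotientMap g₀ (EuclideanSpace.single i 1)) - quotientMap g₀ (x i) := by
        simp only [δ, map_sub]; abel
      rw [e]
      exact hxH i
  show compressedNorm p g T H < r
  linarith

/-- The set of the tuples `g` for which the estimate fails. -/
def badTuples (p : Seminorm ℝ (Euc (n + m))) (k : ℝ) (d : ℕ) (r : ℝ) : Set (Fin m → Euc n) :=
  {g | ∃ T : Euc n →ₗ[ℝ] Euc n, IsMixing k 1 T ∧ ∃ H : Submodule ℝ (Euc n),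
    Module.finrank ℝ H = d ∧ compressedNorm p g T H < r}

/-- Openness survives the uncountable union over `T` and `H`; this is where measurability of the
event comes from. -/
theorem isOpen_badTuples (ha : 0 < a) (hp : ∀ x ∈ euclBall (n + m), a • x ∈ unitBall p)
    (k : ℝ) (d : ℕ) (r : ℝ) : IsOpen (badTuples p k d r) := by
  have : badTuples p k d r = ⋃ T ∈ {T : Euc n →ₗ[ℝ] Euc n | IsMixing k 1 T},
      ⋃ H ∈ {H : Submodule ℝ (Euc n) | Module.finrank ℝ H = d},
        {g | compressedNorm p g T H < r} := by
    ext g; simp [badTuples]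
  rw [this]
  exact isOpen_biUnion fun T _ => isOpen_biUnion fun H _ => isOpen_compressedNorm_lt ha hp T H r

theorem goodEvent_eq {Ω : Type*} (p : Seminorm ℝ (Euc (n + m))) (g : Fin m → Ω → Euc n)
    (k : ℝ) (d : ℕ) (r : ℝ) :
    goodEvent p g k d r = ((fun ω j => g j ω) ⁻¹' badTuples p k d r)ᶜ := by
  ext ω
  simp [goodEvent, badTuples]

end CompressedNorm

/-! ### From a bad tuple to a trap event. -/

section Reduction

variable {n m k d : ℕ} {p : Seminorm ℝ (Euc (n + m))} {a : ℝ}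

theorem quotientMap_single_castAdd (g : Fin m → Euc n) (i : Fin n) :
    quotientMap g (EuclideanSpace.single (Fin.castAdd m i) 1) = EuclideanSpace.single i 1 := by
  simp [quotientMap]

theorem quotientMap_single_natAdd (g : Fin m → Euc n) (j : Fin m) :
    quotientMap g (EuclideanSpace.single (Fin.natAdd n j) 1) = g j := by
  simp [quotientMap]

theorem finrank_add_le_finrank_inf_add (A B : Submodule ℝ (Euc n)) :
    Module.finrank ℝ A + Module.finrank ℝ B ≤ Module.finrank ℝ (A ⊓ B : Submodule ℝ (Euc n)) + n := by
  have h1 := Submodule.finrank_sup_add_finrank_inf_eq A B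
  have h2 : Module.finrank ℝ (A ⊔ B : Submodule ℝ (Euc n)) ≤ n := by
    simpa using Submodule.finrank_le (A ⊔ B)
  omega

theorem le_finrank_ker_add {F : Type*} [AddCommGroup F] [Module ℝ F] [FiniteDimensional ℝ F]
    (φ : Euc n →ₗ[ℝ] F) (U : Submodule ℝ F) (h : ∀ x, φ x ∈ U) :
    n ≤ Module.finrank ℝ (LinearMap.ker φ) + Module.finrank ℝ U := by
  have h1 := LinearMap.finrank_range_add_finrank_ker φ
  have h2 : Module.finrank ℝ (LinearMap.range φ) ≤ Module.finrank ℝ U :=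
    Submodule.finrank_mono (by rintro _ ⟨x, rfl⟩; exact h x)
  rw [finrank_euclideanSpace_fin] at h1
  omega

theorem exists_isometry_range_ge (U : Submodule ℝ (Euc n)) (hU : Module.finrank ℝ U ≤ d)
    (hd : d ≤ n) : ∃ J : Euc d →ₗᵢ[ℝ] Euc n, ∀ x ∈ U, ∃ z, J z = x := by
  have h1 := Submodule.finrank_add_finrank_orthogonal U
  rw [finrank_euclideanSpace_fin] at h1
  obtain ⟨U', hU', hdim⟩ := exists_submodule_finrank_eq Uᗮ (k := n - d) (by omega)
  have h2 := Submodule.finrank_add_finrank_orthogonal U'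
  rw [finrank_euclideanSpace_fin] at h2
  have h3 : Module.finrank ℝ U'ᗮ = d := by omega
  let e := ((stdOrthonormalBasis ℝ U'ᗮ).reindex (finCongr h3)).repr.symm
  refine ⟨U'ᗮ.subtypeₗᵢ.comp e.toLinearIsometry, fun x hx => ?_⟩
  have hx' : x ∈ U'ᗮ := by
    have := Submodule.orthogonal_le hU'
    rw [Submodule.orthogonal_orthogonal] at this
    exact this hx
  refine ⟨e.symm ⟨x, hx'⟩, ?_⟩
  simp

/-- `B` is bounded by `R` on the subspace `F` of dimension at least `k'`, and bounded below by
`1/2` modulo `F` there. -/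
structure IsMixingOn (k' : ℕ) (R : ℝ) (B : Euc n →ₗ[ℝ] Euc n) (F : Submodule ℝ (Euc n)) :
    Prop where
  le_finrank : k' ≤ Module.finrank ℝ F
  mixing : ∀ x ∈ F, ‖x‖ ≤ 2 * ‖Fᗮ.starProjection (B x)‖
  bounded : ∀ x ∈ F, ‖B x‖ ≤ R * ‖x‖

theorem mem_sup_residualSpan (B : Euc n →ₗ[ℝ] Euc n) (F : Submodule ℝ (Euc n))
    (g : Fin m → Euc n) (j : Fin m) : g j ∈ F ⊔ residualSpan B F g := by
  have h1 : F.starProjection (g j) + Fᗮ.starProjection (g j) = g j :=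
    Submodule.starProjection_add_starProjection_orthogonal (g j)
  rw [← h1]
  exact Submodule.add_mem_sup (F.starProjection_apply_mem _)
    (Submodule.mem_sup_left (Submodule.subset_span ⟨j, rfl⟩))

/-- Only `H` modulo `Z = F ⊔ residualSpan` matters, so it may be projected off `Z` and parametrized
by an isometry `J`. The coordinates `w` of the relevant vector are bounded, hence replacing `J` by a
net point costs `a‖w‖` in Euclidean norm and `‖w‖` in `p`. -/
theorem exists_mem_trapEvent (hp : unitBall p ⊆ euclBall (n + m)) (ha : 0 < a)
    (hp' : ∀ x ∈ euclBall (n + m), a • x ∈ unitBall p) {r M : ℝ} (hr : 0 < r) (hM : 0 ≤ M)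
    (hd : d ≤ n) {B : Euc n →ₗ[ℝ] Euc n} {F H : Submodule ℝ (Euc n)} {g : Fin m → Euc n}
    (hH : Module.finrank ℝ H ≤ d) (hB : ∀ x ∈ F, ‖B x‖ ≤ M * r * ‖x‖)
    (hg : ∀ j, ∃ κ, p κ ≤ r * (1 + 14 * ‖g j‖) ∧
      B (g j) - firstCoords n m κ ∈ H ⊔ Submodule.span ℝ (Set.range g))
    (S : Finset (Euc d →L[ℝ] Euc n)) (hS : ∀ J : Euc d →L[ℝ] Euc n, ‖J‖ ≤ 1 →
      ∃ J' ∈ S, ‖J - J'‖ ≤ a) :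
    ∃ J ∈ S, g ∈ trapEvent p (r * (M + 30)) B F (LinearMap.range (J : Euc d →ₗ[ℝ] Euc n)) := by
  set Z := F ⊔ residualSpan B F g with hZ
  let P := Zᗮ.starProjection
  have hP0 : ∀ x ∈ Z, P x = 0 := fun x hx =>
    (Submodule.starProjection_apply_eq_zero_iff Zᗮ).2 (Z.le_orthogonal_orthogonal hx)
  have hP1 : ∀ x, x - P x ∈ Z := fun x => by
    have := Zᗮ.sub_starProjection_mem_orthogonal x
    rwa [Submodule.orthogonal_orthogonal] at this
  obtain ⟨J, hJ⟩ := exists_isometry_range_ge (H.map (P : Euc n →ₗ[ℝ] Euc n))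
    ((Submodule.finrank_map_le _ H).trans hH) hd
  obtain ⟨J', hJ'S, hJJ'⟩ := hS J.toContinuousLinearMap J.norm_toContinuousLinearMap_le
  refine ⟨J', hJ'S, fun j => ?_⟩
  obtain ⟨κ, hκ, hmem⟩ := hg j
  obtain ⟨h, hh, z, hz, hhz⟩ := Submodule.mem_sup.1 hmem
  have hzZ : z ∈ Z := by
    refine (Submodule.span_le.2 ?_) hz
    rintro _ ⟨i, rfl⟩
    exact mem_sup_residualSpan B F g i
  obtain ⟨w, hw⟩ := hJ (P h) ⟨h, hh, rfl⟩
  -- Since `B` is bounded only on `F`, the images of the components orthogonal to `F` were put into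
  -- the residual span and vanish here.
  have hPh : P h = P (B (F.starProjection (g j))) - P (firstCoords n m κ) := by
    have e1 : B (g j) = B (F.starProjection (g j)) + B (Fᗮ.starProjection (g j)) := by
      rw [← map_add, Submodule.starProjection_add_starProjection_orthogonal]
    have e2 : P (B (Fᗮ.starProjection (g j))) = 0 :=
      hP0 _ (Submodule.mem_sup_right (Submodule.mem_sup_right (Submodule.subset_span ⟨j, rfl⟩)))
    have e3 : P (h + z) = P h := by rw [map_add, hP0 z hzZ, add_zero]
    rw [← e3, hhz, map_sub, e1, map_add, e2, add_zero]
  have hwn : ‖w‖ ≤ M * r * ‖g j‖ + r * (1 + 14 * ‖g j‖) := by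
    rw [← J.norm_map, hw, hPh]
    refine (norm_sub_le _ _).trans (add_le_add ?_ ?_)
    · refine (Zᗮ.norm_starProjection_apply_le _).trans ?_
      refine (hB _ (F.starProjection_apply_mem _)).trans ?_
      gcongr
      exact F.norm_starProjection_apply_le _
    · refine (Zᗮ.norm_starProjection_apply_le _).trans ?_
      exact ((norm_firstCoords_le κ).trans (norm_le_seminorm hp κ)).trans hκ
  set e := J w - J' w with he
  have hen : ‖e‖ ≤ a * ‖w‖ := by
    have := (J.toContinuousLinearMap - J').le_opNorm w
    exact this.trans (by gcongr)
  -- The bounds for `κ` and `w` add up to `2r + (M + 28) r‖g_j‖`, strictly less than `s`.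
  set s := r * (M + 30) * (1 + ‖g j‖) with hs
  have hspos : 0 < s := by positivity
  refine ⟨s⁻¹ • (κ + padZero n m e), ?_, ?_⟩
  · rw [map_smul_eq_mul, norm_inv, Real.norm_of_nonneg hspos.le, inv_mul_lt_iff₀ hspos, mul_one]
    have h1 : p (padZero n m e) ≤ ‖w‖ := by
      refine (seminorm_le ha hp' _).trans ?_
      rw [norm_padZero, inv_mul_le_iff₀ ha]
      exact hen
    have h2 := map_add_le_add p κ (padZero n m e)
    have h3 : 0 ≤ r * ‖g j‖ := by positivity
    have h4 : 0 ≤ r * M := by positivity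
    rw [hs]
    nlinarith
  · rw [map_smul, smul_inv_smul₀ hspos.ne', map_add, firstCoords_padZero]
    have e1 : B (g j) - (firstCoords n m κ + e) = J' w + (z + (h - P h)) := by
      rw [← sub_sub, ← hhz, he, hw]; abel
    rw [e1, sup_left_comm]
    exact Submodule.add_mem_sup ⟨w, rfl⟩ (Z.add_mem hzZ (hP1 h))

/-- The columns of `c` are the lifts of the first `n` vertices, so `T = Q c` modulo `H`. Rounding
leaves an error `r A L`: it is at most `14r‖y‖` in `p`, which is all the trap needs, and
Euclidean-small where `L y ∈ W`, which is what mixing needs. -/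
theorem exists_mixing_lift (hp : unitBall p ⊆ euclBall (n + m)) (ha : 0 < a)
    (hp' : ∀ x ∈ euclBall (n + m), a • x ∈ unitBall p) {r M V ζ : ℝ} {k' : ℕ} (hr : 0 < r)
    (hM : 0 ≤ M) (hV : 0 ≤ V) (hrV : 56 * (r * V) ≤ 1) {A : Euc (n + m) ≃ₗ[ℝ] Euc (n + m)}
    (hA : ∀ x, p (A x) ≤ ‖x‖) {W : Submodule ℝ (Euc (n + m))} (hW : Module.finrank ℝ Wᗮ < k)
    (hAW : ∀ x ∈ W, ‖A x‖ ≤ 2 * V * ‖x‖)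
    (hdim : ∀ f w : ℕ, ζ ≤ f → w * M ^ 2 ≤ 225 * n → k' + m + d + k + w ≤ f)
    (S : Finset (Euc n →ₗ[ℝ] Euc (n + m)))
    (hS : ∀ b : Fin n → Euc (n + m), (∀ i, p (b i) ≤ r) → ∃ b' ∈ S,
      ∃ L : Euc n →ₗ[ℝ] Euc (n + m), (∀ x, ‖L x‖ ≤ 14 * ‖x‖) ∧
        ∀ x, columnMap b x = b' x + r • A (L x))
    {g : Fin m → Euc n} {T : Euc n →ₗ[ℝ] Euc n} {H : Submodule ℝ (Euc n)} (hT : IsMixing ζ 1 T)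
    (hH : Module.finrank ℝ H = d) (hlt : compressedNorm p g T H < r) :
    ∃ b' ∈ S, (∃ F, IsMixingOn k' (M * r) (firstCoords n m ∘ₗ b') F) ∧
      ∀ j, ∃ κ, p κ ≤ r * (1 + 14 * ‖g j‖) ∧
        (firstCoords n m ∘ₗ b') (g j) - firstCoords n m κ ∈
          H ⊔ Submodule.span ℝ (Set.range g) := by
  obtain ⟨t, ht0, htr, h⟩ := exists_of_compressedNorm_lt ha hp' hlt
  choose x hx hxH using h
  let c := columnMap fun i => x (Fin.castAdd m i)
  obtain ⟨b', hb'S, L, hL, hc⟩ := hS (fun i => x (Fin.castAdd m i)) fun i => (hx _).trans htr.le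
  have hpA : ∀ y, p (r • A (L y)) ≤ r * (14 * ‖y‖) := fun y => by
    rw [map_smul_eq_mul, Real.norm_of_nonneg hr.le]
    exact mul_le_mul_of_nonneg_left ((hA _).trans (hL y)) hr.le
  let φ : Euc n →ₗ[ℝ] Euc n := T - quotientMap g ∘ₗ c
  have hφ : ∀ y, φ y ∈ H := by
    intro y
    rw [map_eq_sum_single φ y]
    refine H.sum_mem fun i _ => H.smul_mem _ ?_
    have := hxH (Fin.castAdd m i)
    rw [quotientMap_single_castAdd] at this
    simpa [φ, c, columnMap_single] using this
  have hfirst : ∀ y, firstCoords n m y =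
      quotientMap g y - ∑ j, lastCoords n m y j • g j := fun y => by
    rw [quotientMap_apply, add_sub_cancel_right]
  refine ⟨b', hb'S, ?_, fun j => ?_⟩
  -- A column of `b'` has norm at most `r + 14r`, so its large singular values occupy few
  -- dimensions.
  · obtain ⟨F, hF, hmix⟩ := hT
    obtain ⟨W₁, hW₁, hdW₁⟩ := exists_bounded_subspace (firstCoords n m ∘ₗ b') (t := M * r)
      (R := 15 * r) (by positivity) fun i => by
        have e : b' (EuclideanSpace.single i 1) =
            x (Fin.castAdd m i) - r • A (L (EuclideanSpace.single i 1)) := by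
          rw [eq_sub_iff_add_eq, ← hc, columnMap_single]
        refine (norm_firstCoords_le _).trans ((norm_le_seminorm hp _).trans ?_)
        rw [e]
        have h1 := map_sub_le_add p (x (Fin.castAdd m i))
          (r • A (L (EuclideanSpace.single i 1)))
        have h2 := hpA (EuclideanSpace.single i 1)
        have h3 : ‖(EuclideanSpace.single i 1 : Euc n)‖ = 1 := by simp
        rw [h3] at h2
        linarith [hx (Fin.castAdd m i)]
    -- On `K₁` the quotient map acts on `c y` as the first coordinates, on `K₂` one has `T = Q c`,
    -- and on `K₃` the rounding error is small.
    let K₁ := LinearMap.ker (lastCoords n m ∘ₗ c)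
    let K₂ := LinearMap.ker φ
    let K₃ := W.comap L
    have d₁ : n ≤ Module.finrank ℝ K₁ + m := by
      have := le_finrank_ker_add (lastCoords n m ∘ₗ c) ⊤ fun _ => trivial
      rwa [finrank_top, finrank_euclideanSpace_fin] at this
    have d₂ : n ≤ Module.finrank ℝ K₂ + d := by
      have := le_finrank_ker_add φ H hφ
      rwa [hH] at this
    have d₃ : n ≤ Module.finrank ℝ K₃ + k := by
      have := finrank_comap_orthogonal L Wᗮ
      rw [Submodule.orthogonal_orthogonal, finrank_euclideanSpace_fin] at this
      show n ≤ Module.finrank ℝ (W.comap L) + k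
      omega
    have d₄ := Submodule.finrank_add_finrank_orthogonal W₁
    rw [finrank_euclideanSpace_fin] at d₄
    have d₅ := hdim _ (Module.finrank ℝ W₁ᗮ) hF (by
      have hr2 : 0 < r ^ 2 := by positivity
      refine le_of_mul_le_mul_right ?_ hr2
      calc _ = Module.finrank ℝ W₁ᗮ * (M * r) ^ 2 := by ring
        _ ≤ n * (15 * r) ^ 2 := hdW₁
        _ = _ := by ring)
    refine ⟨F ⊓ K₁ ⊓ K₂ ⊓ K₃ ⊓ W₁, ?_, ?_, ?_⟩
    · have i₁ := finrank_add_le_finrank_inf_add F K₁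
      have i₂ := finrank_add_le_finrank_inf_add (F ⊓ K₁) K₂
      have i₃ := finrank_add_le_finrank_inf_add (F ⊓ K₁ ⊓ K₂) K₃
      have i₄ := finrank_add_le_finrank_inf_add (F ⊓ K₁ ⊓ K₂ ⊓ K₃) W₁
      omega
    · intro y hy
      obtain ⟨⟨⟨⟨hyF, hy₁⟩, hy₂⟩, hy₃⟩, -⟩ := hy
      have hTy : T y = firstCoords n m (c y) := by
        have e1 : T y - quotientMap g (c y) = 0 := hy₂
        have e2 : lastCoords n m (c y) = 0 := hy₁
        rw [hfirst, e2, ← sub_eq_zero.1 e1]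
        simp
      have hsplit : T y = (firstCoords n m ∘ₗ b') y + firstCoords n m (r • A (L y)) := by
        rw [hTy, LinearMap.comp_apply, ← map_add, ← hc]
      have hsmall : ‖firstCoords n m (r • A (L y))‖ ≤ 1 / 2 * ‖y‖ := by
        refine (norm_firstCoords_le _).trans ?_
        rw [norm_smul, Real.norm_of_nonneg hr.le]
        calc r * ‖A (L y)‖ ≤ r * (2 * V * ‖L y‖) := by gcongr; exact hAW _ hy₃
          _ ≤ r * (2 * V * (14 * ‖y‖)) := by gcongr; exact hL y
          _ = 56 * (r * V) / 2 * ‖y‖ := by ring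
          _ ≤ 1 / 2 * ‖y‖ := by gcongr
      have h1 := hmix y hyF
      rw [one_mul, hsplit, map_add] at h1
      have h2 := norm_add_le (Fᗮ.starProjection ((firstCoords n m ∘ₗ b') y))
        (Fᗮ.starProjection (firstCoords n m (r • A (L y))))
      have h3 := Fᗮ.norm_starProjection_apply_le (firstCoords n m (r • A (L y)))
      -- Shrinking `F` enlarges its orthogonal complement, so the lower bound for the projection
      -- persists.
      have hle : F ⊓ K₁ ⊓ K₂ ⊓ K₃ ⊓ W₁ ≤ F :=
        inf_le_left.trans (inf_le_left.trans (inf_le_left.trans inf_le_left))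
      have h4 := norm_starProjection_le_of_le (Submodule.orthogonal_le hle)
        ((firstCoords n m ∘ₗ b') y)
      linarith
    · exact fun y hy => hW₁ y hy.2
  · refine ⟨x (Fin.natAdd n j) - r • A (L (g j)), ?_, ?_⟩
    · have h1 := map_sub_le_add p (x (Fin.natAdd n j)) (r • A (L (g j)))
      have h2 := hpA (g j)
      linarith [hx (Fin.natAdd n j)]
    · have e1 : (firstCoords n m ∘ₗ b') (g j) -
          firstCoords n m (x (Fin.natAdd n j) - r • A (L (g j))) =
          firstCoords n m (c (g j) - x (Fin.natAdd n j)) := by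
        have : c (g j) = b' (g j) + r • A (L (g j)) := hc _
        rw [this, LinearMap.comp_apply, ← map_sub]
        congr 1
        abel
      have h1 := hxH (Fin.natAdd n j)
      rw [quotientMap_single_natAdd] at h1
      have h2 : quotientMap g (c (g j) - x (Fin.natAdd n j)) ∈ H := by
        have e2 : quotientMap g (c (g j) - x (Fin.natAdd n j)) =
            (T (g j) - quotientMap g (x (Fin.natAdd n j))) - φ (g j) := by
          simp [φ]
        rw [e2]
        exact H.sub_mem h1 (hφ _)
      rw [e1, hfirst]
      refine Submodule.sub_mem _ (Submodule.mem_sup_left h2) (Submodule.mem_sup_right ?_)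
      exact Submodule.sum_mem _ fun i _ => Submodule.smul_mem _ _ (Submodule.subset_span ⟨i, rfl⟩)

end Reduction

/-! ### Union bound, entropy and parameters. -/

section Main

variable {n m k d : ℕ} {p : Seminorm ℝ (Euc (n + m))} {a : ℝ}

theorem exists_subspace_net (d n : ℕ) (ha : 0 < a) (ha1 : a ≤ 1) :
    ∃ S : Finset (Euc d →L[ℝ] Euc n), (S.card : ℝ) ≤ (3 / a) ^ (d * n) ∧
      ∀ J : Euc d →L[ℝ] Euc n, ‖J‖ ≤ 1 → ∃ J' ∈ S, ‖J - J'‖ ≤ a := by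
  obtain ⟨S, -, hS, hcov⟩ := exists_finset_net_unitBall (Euc d →L[ℝ] Euc n) ha
  refine ⟨S, ?_, hcov⟩
  have h : Module.finrank ℝ (Euc d →L[ℝ] Euc n) = d * n := by
    rw [← (LinearMap.toContinuousLinearMap (𝕜 := ℝ) (E := Euc d) (F' := Euc n)).finrank_eq,
      Module.finrank_linearMap, finrank_euclideanSpace_fin, finrank_euclideanSpace_fin]
  rw [h] at hS
  refine hS.trans (pow_le_pow_left₀ (by positivity) ?_ _)
  rw [le_div_iff₀ ha, add_mul, div_mul_cancel₀ _ ha.ne']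
  linarith

theorem measure_badTuples_le (hp : unitBall p ⊆ euclBall (n + m)) (ha : 0 < a) (ha1 : a ≤ 1)
    (hp' : ∀ x ∈ euclBall (n + m), a • x ∈ unitBall p) {ρ r M ζ : ℝ} (hρ : volumeRatio p ≤ ρ)
    (hρ1 : 0 ≤ ρ) (hn : 0 < n) (hk : 1 ≤ k) (hkn : k ≤ n) (hd : d ≤ n) (hr : 0 < r) (hM : 0 ≤ M)
    (hrV : 56 * (r * volumeNumber k p) ≤ 1)
    (hdim : ∀ f w : ℕ, ζ ≤ f → w * M ^ 2 ≤ 225 * n →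
      (d + 2 * m + k) + m + d + k + w ≤ f) :
    Measure.pi (fun _ : Fin m => gaussianLaw n) (badTuples p ζ d r) ≤
      ENNReal.ofReal ((2 * (144 * ρ) ^ (n + m)) ^ n * (3 / a) ^ (d * n) *
        (20 ^ n * (2 * (M + 30) * (r * volumeNumber k p)) ^ k) ^ m) := by
  classical
  have hV : 0 ≤ volumeNumber k p := volumeNumber_nonneg
  have hc := continuous_seminorm ha hp'
  obtain ⟨A, hA, hvol⟩ := exists_ellipsoid (by omega) hρ hp ha hp'
  obtain ⟨W, hW, hAW⟩ := exists_thin_subspace hp ha hp' hk (by omega : k ≤ n + m) A hA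
  obtain ⟨S, hScard, hS⟩ := exists_column_net (n := n) (by omega) (by omega) A hA hρ1 hvol hr
  obtain ⟨S', hS'card, hS'⟩ := exists_subspace_net d n ha ha1
  -- The subspace is chosen from `b` alone, independently of `g`; hence no net of mixing subspaces
  -- is needed.
  let E : (Euc n →ₗ[ℝ] Euc (n + m)) → (Euc d →L[ℝ] Euc n) → Set (Fin m → Euc n) := fun b J =>
    if h : ∃ F, IsMixingOn (d + 2 * m + k) (M * r) (firstCoords n m ∘ₗ b) F then
      trapEvent p (r * (M + 30)) (firstCoords n m ∘ₗ b) h.choose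
        (LinearMap.range (J : Euc d →ₗ[ℝ] Euc n))
    else ∅
  set β : ℝ := (20 ^ n * (2 * (M + 30) * (r * volumeNumber k p)) ^ k) ^ m with hβ
  have hβ0 : 0 ≤ β := by positivity
  have hE : ∀ b J, Measure.pi (fun _ : Fin m => gaussianLaw n) (E b J) ≤ ENNReal.ofReal β := by
    intro b J
    by_cases h : ∃ F, IsMixingOn (d + 2 * m + k) (M * r) (firstCoords n m ∘ₗ b) F
    · simp only [E, dif_pos h]
      have hF := h.choose_spec
      have hJ : Module.finrank ℝ (LinearMap.range (J : Euc d →ₗ[ℝ] Euc n)) ≤ d := by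
        simpa using LinearMap.finrank_range_le (J : Euc d →ₗ[ℝ] Euc n)
      have h1 := hF.le_finrank
      refine (pi_gaussianLaw_trapEvent_le hp hc hn hk hkn (by positivity) _ h.choose _
        hF.mixing (by omega)).trans (le_of_eq ?_)
      rw [hβ]
      congr 4
      ring
    · simp only [E, dif_neg h, measure_empty, zero_le]
  have hsub : badTuples p ζ d r ⊆ ⋃ b ∈ S, ⋃ J ∈ S', E b J := by
    rintro g ⟨T, hT, H, hH, hlt⟩
    obtain ⟨b, hb, hmix, hg⟩ := exists_mixing_lift hp ha hp' hr hM hV hrV hA hW hAW hdim S hS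
      hT hH hlt
    obtain ⟨J, hJ, hmem⟩ := exists_mem_trapEvent hp ha hp' hr hM hd hH.le
      hmix.choose_spec.bounded hg S' hS'
    refine Set.mem_iUnion₂.2 ⟨b, hb, Set.mem_iUnion₂.2 ⟨J, hJ, ?_⟩⟩
    simp only [E, dif_pos hmix]
    exact hmem
  calc _ ≤ ∑ b ∈ S, ∑ J ∈ S', Measure.pi (fun _ : Fin m => gaussianLaw n) (E b J) := by
        refine (measure_mono hsub).trans ((measure_biUnion_finset_le _ _).trans ?_)
        exact Finset.sum_le_sum fun b _ => measure_biUnion_finset_le _ _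
    _ ≤ ∑ _b ∈ S, ∑ _J ∈ S', ENNReal.ofReal β :=
        Finset.sum_le_sum fun b _ => Finset.sum_le_sum fun J _ => hE b J
    _ = ENNReal.ofReal (S.card * (S'.card * β)) := by
        rw [Finset.sum_const, Finset.sum_const, nsmul_eq_mul, nsmul_eq_mul,
          ENNReal.ofReal_mul (by positivity), ENNReal.ofReal_mul (by positivity),
          ENNReal.ofReal_natCast, ENNReal.ofReal_natCast]
    _ ≤ _ := by
        refine ENNReal.ofReal_le_ofReal ?_
        rw [← mul_assoc]
        gcongr

/-- The entropy of the nets is absorbed by the small ball probabilities. -/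
theorem entropy_bound {ε η δ ρ M c a : ℝ} (hε : 0 < ε) (hη : 0 < η) (hρ : 1 ≤ ρ) (hM : 0 ≤ M)
    (ha : 0 < a) (ha1 : a ≤ 1) (hm : m ≤ n) (hd : d ≤ n) (hk : k ≤ n)
    (hkm : ε * η / 16 * n ^ 2 ≤ (k * m : ℕ)) (hdk : ((d * n : ℕ) : ℝ) ≤ δ * (k * m : ℕ))
    (hc : c = (1 / (2 * (2 * (144 * ρ) ^ 2 * 3 * 20 * (2 * (M + 30))))) ^ (16 / (ε * η))) :
    (2 * (144 * ρ) ^ (n + m)) ^ n * (3 / a) ^ (d * n) *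
        (20 ^ n * (2 * (M + 30) * (c * a ^ δ)) ^ k) ^ m ≤ (1 / 2) ^ (n ^ 2) := by
  set D : ℝ := 2 * (144 * ρ) ^ 2 * 3 * 20 * (2 * (M + 30)) with hD
  have hD0 : 0 < D := by positivity
  have hD1 : 1 ≤ D := by
    have : (1 : ℝ) ≤ (144 * ρ) ^ 2 := one_le_pow₀ (by linarith)
    rw [hD]; nlinarith
  have hc0 : 0 < c := by rw [hc]; positivity
  have hc1 : c ≤ 1 := by
    rw [hc]
    refine Real.rpow_le_one (by positivity) ?_ (by positivity)
    rw [div_le_one (by positivity)]; linarith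
  have e1 : (2 * (144 * ρ) ^ (n + m)) ^ n ≤ (2 * (144 * ρ) ^ 2) ^ (n ^ 2) := by
    have h144 : 1 ≤ 144 * ρ := by linarith
    calc (2 * (144 * ρ) ^ (n + m)) ^ n = 2 ^ n * (144 * ρ) ^ ((n + m) * n) := by
          rw [mul_pow 2, pow_mul]
      _ ≤ 2 ^ (n ^ 2) * (144 * ρ) ^ (2 * n ^ 2) :=
          mul_le_mul (pow_le_pow_right₀ one_le_two (Nat.le_self_pow two_ne_zero n))
            (pow_le_pow_right₀ h144 (by nlinarith)) (by positivity) (by positivity)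
      _ = _ := by rw [mul_pow 2, ← pow_mul]
  have e2 : (3 / a) ^ (d * n) ≤ 3 ^ (n ^ 2) * a ^ (-((d * n : ℕ) : ℝ)) := by
    rw [div_pow, Real.rpow_neg ha.le, Real.rpow_natCast, div_eq_mul_inv]
    gcongr
    · norm_num
    · nlinarith
  have e3 : (20 ^ n * (2 * (M + 30) * (c * a ^ δ)) ^ k) ^ m ≤
      20 ^ (n ^ 2) * ((2 * (M + 30)) ^ (n ^ 2) * ((1 / (2 * D)) ^ (n ^ 2) *
        a ^ (δ * (k * m : ℕ)))) := by
    have f1 : (a ^ δ) ^ (k * m) = a ^ (δ * (k * m : ℕ)) := by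
      rw [← Real.rpow_natCast, ← Real.rpow_mul ha.le]
    -- The exponent `16/(εη)` in `c` is the inverse of the constant in `km ≥ (εη/16) n²`.
    have f2 : c ^ (k * m) ≤ (1 / (2 * D)) ^ (n ^ 2) := by
      rw [← Real.rpow_natCast]
      refine (Real.rpow_le_rpow_of_exponent_ge hc0 hc1 hkm).trans (le_of_eq ?_)
      rw [hc, ← Real.rpow_mul (by positivity)]
      have : 16 / (ε * η) * (ε * η / 16 * (n : ℝ) ^ 2) = ((n ^ 2 : ℕ) : ℝ) := by
        push_cast; field_simp
      rw [this, Real.rpow_natCast]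
    rw [mul_pow (20 ^ n), ← pow_mul, ← pow_mul, mul_pow (2 * (M + 30)), mul_pow c, f1]
    gcongr
    · norm_num
    · nlinarith
    · linarith
    · nlinarith
  have e4 : a ^ (-((d * n : ℕ) : ℝ)) * a ^ (δ * (k * m : ℕ)) ≤ 1 := by
    rw [← Real.rpow_add ha]
    exact Real.rpow_le_one ha.le ha1 (by linarith)
  calc _ ≤ (2 * (144 * ρ) ^ 2) ^ (n ^ 2) * (3 ^ (n ^ 2) * a ^ (-((d * n : ℕ) : ℝ))) *
        (20 ^ (n ^ 2) * ((2 * (M + 30)) ^ (n ^ 2) * ((1 / (2 * D)) ^ (n ^ 2) *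
          a ^ (δ * (k * m : ℕ))))) := by gcongr
    _ = D ^ (n ^ 2) * (1 / (2 * D)) ^ (n ^ 2) *
        (a ^ (-((d * n : ℕ) : ℝ)) * a ^ (δ * (k * m : ℕ))) := by
        rw [hD]; simp only [mul_pow]; ring
    _ ≤ D ^ (n ^ 2) * (1 / (2 * D)) ^ (n ^ 2) * 1 := by gcongr
    _ = _ := by
        rw [mul_one, ← mul_pow]
        congr 1
        field_simp

/-- Dimension budget in units of `ηn`: the two `k` use `1/2`, `w` uses `1/8`, and three `m` with two
`d` use at most `5/32`. Since `ηn ≥ 32`, rounding down costs `k` at most a factor of two. -/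
theorem parameter_bounds {ε η δ γ : ℝ} (hη : 0 < η) (hη1 : η < 3 / 8) (hε : 0 < ε)
    (hεη : ε < η / 2 ^ 5) (hδ : 0 < δ) (hδ1 : δ < 1) (hγ : γ = δ * ε * η / 2 ^ 5)
    (hεn : 1 ≤ ε * n) (hm : m = ⌊ε * n⌋₊) (hk : k = ⌊η * n / 4⌋₊) (hd : d = ⌊γ * n⌋₊) :
    0 < n ∧ 1 ≤ k ∧ k ≤ n ∧ m ≤ n ∧ d ≤ n ∧ ε * η / 16 * n ^ 2 ≤ (k * m : ℕ) ∧
      ((d * n : ℕ) : ℝ) ≤ δ * (k * m : ℕ) ∧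
      ∀ f w : ℕ, η * n ≤ f → w * (1800 / η) ≤ 225 * n →
        (d + 2 * m + k) + m + d + k + w ≤ f := by
  have hn0 : (0 : ℝ) < n := by
    by_contra! h
    nlinarith
  have hn : 0 < n := by exact_mod_cast hn0
  have hηn : 32 * (ε * n) ≤ η * n := by
    have : ε * 32 ≤ η := by linarith
    nlinarith
  have hmle : (m : ℝ) ≤ ε * n := by rw [hm]; exact Nat.floor_le (by positivity)
  have hmge : ε * n / 2 ≤ m := by
    have h1 : ε * n < m + 1 := by rw [hm]; exact Nat.lt_floor_add_one _
    have h2 : (1 : ℝ) ≤ m := by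
      have : 1 ≤ m := by rw [hm]; exact Nat.le_floor (by simpa using hεn)
      exact_mod_cast this
    linarith
  have hkle : (k : ℝ) ≤ η * n / 4 := by rw [hk]; exact Nat.floor_le (by positivity)
  have hkge : η * n / 8 ≤ k := by
    have h1 : η * n / 4 < k + 1 := by rw [hk]; exact Nat.lt_floor_add_one _
    linarith
  have hγ0 : 0 < γ := by rw [hγ]; positivity
  have hdle : (d : ℝ) ≤ δ * (ε * (η * n)) / 32 := by
    rw [hd]
    refine (Nat.floor_le (by positivity)).trans (le_of_eq ?_)
    rw [hγ]; ring
  have hηn1 : η * n ≤ n := by nlinarith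
  have hk1 : 1 ≤ k := by rw [hk]; exact Nat.le_floor (by push_cast; linarith)
  have hkn : k ≤ n := by
    have : (k : ℝ) ≤ n := by linarith
    exact_mod_cast this
  have hmn : m ≤ n := by
    have : (m : ℝ) ≤ n := by linarith
    exact_mod_cast this
  have hε1 : ε ≤ 1 := by linarith
  have hεηn : ε * (η * n) ≤ η * n := by nlinarith
  have hdle2 : (d : ℝ) ≤ η * n / 32 := by
    have : δ * (ε * (η * n)) ≤ ε * (η * n) := by
      have : 0 ≤ ε * (η * n) := by positivity
      nlinarith
    linarith
  have hdn : d ≤ n := by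
    have : (d : ℝ) ≤ n := by linarith
    exact_mod_cast this
  refine ⟨hn, hk1, hkn, hmn, hdn, ?_, ?_, fun f w hf hw => ?_⟩
  · push_cast
    calc ε * η / 16 * (n : ℝ) ^ 2 = (η * n / 8) * (ε * n / 2) := by ring
      _ ≤ k * m := by gcongr
  · push_cast
    calc (d : ℝ) * n ≤ δ * (ε * (η * n)) / 32 * n := by gcongr
      _ = δ * ((η * n / 8) * (ε * n / 2)) / 2 := by ring
      _ ≤ δ * ((η * n / 8) * (ε * n / 2)) := half_le_self (by positivity)
      _ ≤ δ * (k * m) := by gcongr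
  · have hw' : (w : ℝ) ≤ η * n / 8 := by
      have h1 : w * (1800 / η) = w * 1800 / η := by ring
      rw [h1, div_le_iff₀ hη] at hw
      linarith
    have : ((((d + 2 * m + k) + m + d + k + w : ℕ)) : ℝ) ≤ f := by
      push_cast
      linarith
    exact_mod_cast this

end Main

end RandomQuotients

end

open RandomQuotients in
theorem mainTheorem6 :
    ∃ c₁ : ℝ, 0 < c₁ ∧ c₁ < 1 ∧
      ∀ ε η ρ : ℝ, 0 < η → η < 3 / 8 → 0 < ε → ε < η / 2 ^ 5 → 1 ≤ ρ →
        ∃ c : ℝ, 0 < c ∧ c < 1 ∧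
          ∀ (δ γ : ℝ) (n m : ℕ), 0 < δ → δ < 1 → γ = δ * ε * η / 2 ^ 5 →
            1 ≤ ε * n → m = ⌊ε * n⌋₊ →
            ∀ (p : Seminorm ℝ (Euc (n + m))) (a : ℝ),
              unitBall p ⊆ euclBall (n + m) → volumeRatio p ≤ ρ →
              0 < a → a ≤ 1 → (∀ x ∈ euclBall (n + m), a • x ∈ unitBall p) →
              ∀ (Ω : Type*) [MeasurableSpace Ω] (P : Measure Ω) [IsProbabilityMeasure P]
                (g : Fin m → Ω → Euc n),
                (∀ j, Measurable (g j)) → (∀ j, P.map (g j) = gaussianLaw n) →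
                iIndepFun g P →
                MeasurableSet (goodEvent p g (η * n) ⌊γ * n⌋₊
                  (c * (volumeNumber ⌊η * n / 4⌋₊ p)⁻¹ * a ^ δ)) ∧
                1 - c₁ ^ (n ^ 2) ≤ P.real (goodEvent p g (η * n) ⌊γ * n⌋₊
                  (c * (volumeNumber ⌊η * n / 4⌋₊ p)⁻¹ * a ^ δ)) := by
  refine ⟨1 / 2, by norm_num, by norm_num, fun ε η ρ hη hη1 hε hεη hρ => ?_⟩
  -- With this value, `225n / M² = ηn/8` dimensions are lost to large singular values.
  set M : ℝ := √(1800 / η) with hM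
  have hM0 : 0 ≤ M := Real.sqrt_nonneg _
  have hM2 : M ^ 2 = 1800 / η := Real.sq_sqrt (by positivity)
  set D : ℝ := 2 * (144 * ρ) ^ 2 * 3 * 20 * (2 * (M + 30)) with hD
  have hD28 : 28 ≤ D := by
    have : (1 : ℝ) ≤ (144 * ρ) ^ 2 := one_le_pow₀ (by linarith)
    rw [hD]; nlinarith
  have hD0 : 0 < D := by linarith
  obtain ⟨c, hc⟩ : ∃ c : ℝ, c = (1 / (2 * D)) ^ (16 / (ε * η)) := ⟨_, rfl⟩
  have hc0 : 0 < c := by rw [hc]; positivity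
  -- This gives `56 r V ≤ 1`, so the rounding error uses at most half of the mixing constant.
  have hc56 : c ≤ 1 / 56 := by
    have hεη1 : ε * η ≤ 1 := by nlinarith
    have h16 : 1 ≤ 16 / (ε * η) := by
      rw [le_div_iff₀ (by positivity)]; linarith
    calc c ≤ (1 / (2 * D)) ^ (1 : ℝ) := by
          rw [hc]
          refine Real.rpow_le_rpow_of_exponent_ge (by positivity) ?_ h16
          rw [div_le_one (by positivity)]; linarith
      _ = 1 / (2 * D) := Real.rpow_one _
      _ ≤ 1 / 56 := one_div_le_one_div_of_le (by norm_num) (by linarith)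
  refine ⟨c, hc0, by linarith, ?_⟩
  intro δ γ n m hδ hδ1 hγ hεn hm p a hp hvr ha ha1 hp' Ω _ P _ g hg hlaw hind
  set k := ⌊η * n / 4⌋₊ with hk
  set d := ⌊γ * n⌋₊ with hd
  obtain ⟨hn, hk1, hkn, hmn, hdn, hkm, hdk, hdim⟩ :=
    parameter_bounds hη hη1 hε hεη hδ hδ1 hγ hεn hm hk hd
  have hV := volumeNumber_pos hp ha hp' hk1 (by omega : k ≤ n + m)
  have haδ : 0 < a ^ δ := Real.rpow_pos_of_pos ha δ
  set r := c * (volumeNumber k p)⁻¹ * a ^ δ with hr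
  have hr0 : 0 < r := by positivity
  have hrV : r * volumeNumber k p = c * a ^ δ := by
    rw [hr]; field_simp
  have hmeasbad : MeasurableSet (badTuples p (η * n) d r) :=
    (isOpen_badTuples ha hp' _ _ _).measurableSet
  have hgm : Measurable fun ω j => g j ω := measurable_pi_lambda _ hg
  have hmap : P.map (fun ω j => g j ω) = Measure.pi fun _ : Fin m => gaussianLaw n := by
    rw [(iIndepFun_iff_map_fun_eq_pi_map fun j => (hg j).aemeasurable).1 hind]
    simp_rw [hlaw]
  have hbound : P ((fun ω j => g j ω) ⁻¹' badTuples p (η * n) d r) ≤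
      ENNReal.ofReal ((1 / 2) ^ (n ^ 2)) := by
    rw [← Measure.map_apply hgm hmeasbad, hmap]
    refine (measure_badTuples_le hp ha ha1 hp' hvr (by linarith) hn hk1 hkn hdn hr0 hM0 ?_
      ?_).trans (ENNReal.ofReal_le_ofReal ?_)
    · rw [hrV]
      have : a ^ δ ≤ 1 := Real.rpow_le_one ha.le ha1 hδ.le
      nlinarith
    · rwa [hM2]
    · rw [hrV]
      exact entropy_bound hε hη hρ hM0 ha ha1 hmn hdn hkn hkm hdk hc
  rw [goodEvent_eq]
  refine ⟨(hgm hmeasbad).compl, ?_⟩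
  rw [probReal_compl_eq_one_sub (hgm hmeasbad)]
  have := ENNReal.toReal_le_of_le_ofReal (by positivity) hbound
  rw [measureReal_def]
  linarith
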